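/- Let $\mathbb S^1=\mathbb R/\mathbb Z$ and let $U:\mathbb R\to\mathbb R$ be smooth and skew periodic, $U(x+1)=U(x)-\bar b$ for a constant $\bar b$. Assume that the critical points of $U$ are exactly the points $x_i$ and $x_{i+\frac12}$, $i\in\mathbb Z$, where for some $k\ge 1$ $$x_{i-\frac12}<x_i<x_{i+\frac12},\qquad x_{i+k}=x_i+1,\qquad x_{i+k+\frac12}=x_{i+\frac12}+1\qquad (i\in\mathbb Z),$$ each $x_i$ is a local minimum of $U$ and each $x_{i+\frac12}$ is a local maximum of $U$. Let $L(s,x)=\frac14\,(s+U'(x))^2$; it is $1$-periodic in $x$ and hence a Lagrangian on $\mathbb R\times\mathbb S^1$. All infima below are over absolutely continuous curves. For $x,y\in\mathbb R$ put $$\beta(y;x)=\inf_{T\ge 0,\ \gamma:[0,T]\to\mathbb R,\ \gamma(0)=x,\ \gamma(T)=y}\int_0^T L(\dot\gamma,\gamma)\,dt ,$$ and for $x,y\in\mathbb S^1$ define the Peierls barrier $$h(y;x)=\liminf_{T\to+\infty}\ \inf_{\gamma:[0,T]\to\mathbb S^1,\ \gamma(0)=x,\ \gamma(T)=y}\int_0^T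 L(\dot\gamma,\gamma)\,dt .$$ For $1\le i,j\le k$ let $\tilde h_R(x_i;x_{j+1})$ be $\beta(x_i;x_{j+1})$ if $j<i$ and $\beta(x_{i+k};x_{j+1})$ if $j\ge i$, and let $\tilde h_L(x_i;x_j)$ be $\beta(x_i;x_j)$ if $j\ge i$ and $\beta(x_{i-k};x_j)$ if $j<i$. Set $$W_i=\min_{1\le j\le k}\bigl(\tilde h_R(x_i;x_{j+1})+\tilde h_L(x_i;x_j)\bigr),\qquad W(x)=\min_{1\le j\le k}\bigl(W_j+h(x;x_j)\bigr),\quad x\in\mathbb S^1 .$$ A backward calibrated curve for $W$ is a continuous, piecewise $C^1$ curve $\gamma:(-\infty,0]\to\mathbb S^1$ with $W(\gamma(b))-W(\gamma(a))=\int_a^b L(\dot\gamma,\gamma)\,dt$ for all $a<b\le 0$. The projected Aubry set is $\mathcal A=\{x\in\mathbb S^1: h(x;x)=0\}$. A Mather measure is a Borel probability measure on $\mathbb R\times\mathbb S^1$ that is invariant under the Euler–Lagrange flow of $L$ and minimizes $\int L\,d\mu$ among all such invariant probability measures. The projected Mather set $\mathcal M_0$ is the image in $\mathbb S^1$ of the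 closure of the union of the supports of all Mather measures. Then: (i) for each $x\in\mathbb S^1$ there is a backward calibrated curve $\gamma$ for $W$ with $\gamma(0)=x$ that solves $\dot\gamma=U'(\gamma)$ on $(-\infty,0]$ or solves $\dot\gamma=-U'(\gamma)$ on $(-\infty,0]$, and $\gamma(t)$ converges to a critical point of $U$ as $t\to-\infty$; (ii) $\mathcal M_0=\mathcal A=\{x_i,\,x_{i+\frac12}\,;\ i=1,\dots,k\}$ as subsets of $\mathbb S^1$, that is, the set of all local minima and maxima of $U$. -/

import Mathlib

open scoped ENNReal ContDiff Topology
open MeasureTheory Filter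

noncomputable section

/- The circle is `UnitAddCircle = ℝ / ℤ`. A curve on the circle is given by a (continuous) lift
`γ : ℝ → ℝ`; its position on the circle at time `t` is `(γ t : UnitAddCircle)`. As `U'` is
1-periodic, the Lagrangian is the same along every lift. -/

/-- The Lagrangian `L(s, x) = (s + U'(x))² / 4`, the convex conjugate of `H(p, x) = p (p - U'(x))`. -/
def lagrangian (U : ℝ → ℝ) (s x : ℝ) : ℝ := (s + deriv U x) ^ 2 / 4

/-- The action `∫_a^b L(γ', γ) dt ∈ [0, ∞]` of a curve. -/
def action (U γ : ℝ → ℝ) (a b : ℝ) : ℝ≥0∞ :=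
  ∫⁻ t in Set.Icc a b, ENNReal.ofReal (lagrangian U (deriv γ t) (γ t))

/-- The least action from `x` to `y` in the universal cover `ℝ`, the duration `T ≥ 0` being free.
For `x ≤ y` it is the right barrier `h_R(y; x)`, for `y ≤ x` the left barrier `h_L(y; x)`. -/
def coverBarrier (U : ℝ → ℝ) (y x : ℝ) : ℝ≥0∞ :=
  ⨅ (T : ℝ) (γ : ℝ → ℝ) (_ : 0 ≤ T) (_ : AbsolutelyContinuousOnInterval γ 0 T)
    (_ : γ 0 = x) (_ : γ T = y), action U γ 0 T

/-- The least action from `x` to `y` on the circle in time exactly `T`. -/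
def leastAction (U : ℝ → ℝ) (T : ℝ) (y x : UnitAddCircle) : ℝ≥0∞ :=
  ⨅ (γ : ℝ → ℝ) (_ : AbsolutelyContinuousOnInterval γ 0 T)
    (_ : (γ 0 : UnitAddCircle) = x) (_ : (γ T : UnitAddCircle) = y), action U γ 0 T

/-- The Peierls barrier `h(y; x)`. -/
def peierlsBarrier (U : ℝ → ℝ) (y x : UnitAddCircle) : ℝ≥0∞ :=
  liminf (fun T : ℝ => leastAction U T y x) atTop

/-- The cost of the counterclockwise path on the circle from the minimum `x_{j+1}` to `x_i`,
where `1 ≤ i, j ≤ k` and `m i = x_i`. -/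
def ccwCost (U : ℝ → ℝ) (k : ℕ) (m : ℤ → ℝ) (i j : ℤ) : ℝ≥0∞ :=
  if j < i then coverBarrier U (m i) (m (j + 1)) else coverBarrier U (m (i + k)) (m (j + 1))

/-- The cost of the clockwise path on the circle from the minimum `x_j` to `x_i`. -/
def cwCost (U : ℝ → ℝ) (k : ℕ) (m : ℤ → ℝ) (i j : ℤ) : ℝ≥0∞ :=
  if i ≤ j then coverBarrier U (m i) (m j) else coverBarrier U (m (i - k)) (m j)

/-- The Freidlin-Wentzell boundary value `W_i` at the minimum `x_i`. -/
def boundaryValue (U : ℝ → ℝ) (k : ℕ) (m : ℤ → ℝ) (i : ℤ) : ℝ≥0∞ :=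
  ⨅ j ∈ Finset.Icc (1 : ℤ) k, (ccwCost U k m i j + cwCost U k m i j)

/-- The Freidlin-Wentzell landscape `W(x) = min_j (W_j + h(x; x_j))`. -/
def landscape (U : ℝ → ℝ) (k : ℕ) (m : ℤ → ℝ) (x : UnitAddCircle) : ℝ :=
  (⨅ j ∈ Finset.Icc (1 : ℤ) k,
    (boundaryValue U k m j + peierlsBarrier U x (m j : UnitAddCircle))).toReal

/-- `γ` is continuous and piecewise `C¹` (up to the break points) on `[a, b]`. -/
def PiecewiseC1On (γ : ℝ → ℝ) (a b : ℝ) : Prop :=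
  ContinuousOn γ (Set.Icc a b) ∧
    ∃ (n : ℕ) (τ : ℕ → ℝ), Monotone τ ∧ τ 0 = a ∧ τ n = b ∧
      ∀ i < n, ContDiffOn ℝ 1 γ (Set.Icc (τ i) (τ (i + 1)))

/-- `γ : (-∞, 0] → 𝕊¹` (given by a lift, of which only the values at `t ≤ 0` matter) is a backward
calibrated curve for `u`. -/
def IsCalibratedCurve (U : ℝ → ℝ) (u : UnitAddCircle → ℝ) (γ : ℝ → ℝ) : Prop :=
  (∀ a ≤ 0, PiecewiseC1On γ a 0) ∧
    ∀ a b : ℝ, a < b → b ≤ 0 →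
      u (γ b : UnitAddCircle) - u (γ a : UnitAddCircle) =
        ∫ t in a..b, lagrangian U (deriv γ t) (γ t)

/-- The projected Aubry set `{x | h(x; x) = 0}`. -/
def projectedAubrySet (U : ℝ → ℝ) : Set UnitAddCircle :=
  {x | peierlsBarrier U x x = 0}

/-- `γ` solves the Euler-Lagrange equation `d/dt ∂_s L(γ', γ) = ∂_x L(γ', γ)`. -/
def IsEulerLagrangeCurve (U : ℝ → ℝ) (γ : ℝ → ℝ) : Prop :=
  ContDiff ℝ 2 γ ∧ ∀ t : ℝ,
    deriv (fun r => deriv (fun s => lagrangian U s (γ r)) (deriv γ r)) t =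
      deriv (fun z => lagrangian U (deriv γ t) z) (γ t)

/-- The point `(γ'(t), γ(t))` of the tangent bundle `ℝ × 𝕊¹`. -/
def tangentLift (γ : ℝ → ℝ) (t : ℝ) : ℝ × UnitAddCircle := (deriv γ t, (γ t : UnitAddCircle))

/-- The preimage of `B` under the time-`t` map of the Euler-Lagrange flow on `ℝ × 𝕊¹`. -/
def flowPreimage (U : ℝ → ℝ) (t : ℝ) (B : Set (ℝ × UnitAddCircle)) :
    Set (ℝ × UnitAddCircle) :=
  {p | ∃ γ : ℝ → ℝ, IsEulerLagrangeCurve U γ ∧ tangentLift γ 0 = p ∧ tangentLift γ t ∈ B}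

/-- `μ` is a probability measure on `ℝ × 𝕊¹` that is invariant under the Euler-Lagrange flow. -/
def IsInvariantProb (U : ℝ → ℝ) (μ : Measure (ℝ × UnitAddCircle)) : Prop :=
  IsProbabilityMeasure μ ∧
    ∀ (t : ℝ) (B : Set (ℝ × UnitAddCircle)), MeasurableSet B → μ (flowPreimage U t B) = μ B

/-- The average action `∫ L dμ` (the point `x` of the circle being represented in `[0, 1)`). -/
def averageAction (U : ℝ → ℝ) (μ : Measure (ℝ × UnitAddCircle)) : ℝ≥0∞ :=
  ∫⁻ p, ENNReal.ofReal (lagrangian U p.1 (AddCircle.equivIco (1 : ℝ) 0 p.2 : ℝ)) ∂μ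

/-- Mather measures: the invariant probability measures of least average action. -/
def IsMatherMeasure (U : ℝ → ℝ) (μ : Measure (ℝ × UnitAddCircle)) : Prop :=
  IsInvariantProb U μ ∧ ∀ ν, IsInvariantProb U ν → averageAction U μ ≤ averageAction U ν

/-- The Mather set: the closure of the union of the supports of all Mather measures. -/
def matherSet (U : ℝ → ℝ) : Set (ℝ × UnitAddCircle) :=
  closure {p | ∃ μ, IsMatherMeasure U μ ∧ p ∈ μ.support}

/-- The projected Mather set. -/
def projectedMatherSet (U : ℝ → ℝ) : Set UnitAddCircle := Prod.snd '' matherSet U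

end

noncomputable section

/-! ### Absolutely continuous curves -/

/-! Everything rests on two linear lower bounds for the Lagrangian, `ψ x * s ≤ L(s, x)` with `ψ =
max U' 0` or `ψ = min U' 0`. If `Ψ' = ψ`, the action of any curve is at least the increment of `Ψ`.
Equality holds for `ψ = max U' 0` at speed `|U'|` and for `ψ = min U' 0` at speed `-|U'|`. So, to
the right or to the left, the optimal motion between critical points follows `U'` or `-U'`.

Calibrated curves: waiting at an equilibrium is free, so the barrier from it is the least action in
free time, and `W` is a minimum over curves issued from minima. A nearly optimal curve to `x` sweeps
the whole arc between `x` and the next critical point on one side. Hence one of the two trajectories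
reaching `x` realises the increments of `W` (`minBarrier_left_or_right`,
`isCalibratedCurve_minBarrier`). The argument works for any finite weights at the minima.

Aubry set: a loop of duration at least 1 through a noncritical point winds around the circle, makes
an excursion or lingers near the point. Each has a cost bounded below
(`exists_pos_le_action_of_loop`).

Mather set: Dirac masses at equilibria have zero action, so every Mather measure lives on the graph
of `-U'`, where the flow is the gradient flow. Noncritical points wander under it and carry no mass
(`IsMatherMeasure.snd_mem_criticalSet`). -/

theorem AbsolutelyContinuousOnInterval.comp_monotone {f φ : ℝ → ℝ} {a b c d : ℝ}
    (hf : AbsolutelyContinuousOnInterval f c d) (hφ : Monotone φ)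
    (hlip : ∀ x y, dist (φ x) (φ y) ≤ dist x y)
    (hmaps : ∀ x ∈ Set.uIcc a b, φ x ∈ Set.uIcc c d) :
    AbsolutelyContinuousOnInterval (fun t => f (φ t)) a b := by
  rw [absolutelyContinuousOnInterval_iff] at hf ⊢
  intro ε hε
  obtain ⟨δ, hδ, h⟩ := hf ε hε
  refine ⟨δ, hδ, fun E hE hEδ => ?_⟩
  refine h (E.1, fun i => (φ (E.2 i).1, φ (E.2 i).2)) ⟨fun i hi => ?_, ?_⟩ ?_
  · exact ⟨hmaps _ (hE.1 i hi).1, hmaps _ (hE.1 i hi).2⟩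
  · intro i hi j hj hij
    have hdis := hE.2 hi hj hij
    simp only [Function.onFun, Set.disjoint_left, Set.mem_uIoc] at hdis ⊢
    intro z hz1 hz2
    -- If `z` lies in both image intervals, the smaller of the two right endpoints lies in both
    -- original half-open intervals.
    have key : ∀ x y x' y' : ℝ, φ x < z → z ≤ φ y → φ x' < z → z ≤ φ y' →
        x < min y y' ∧ x' < min y y' := by
      intro x y x' y' h1 h2 h3 h4
      refine ⟨lt_min ?_ ?_, lt_min ?_ ?_⟩ <;> refine hφ.reflect_lt ?_ <;> linarith
    rcases hz1 with ⟨h1, h2⟩ | ⟨h1, h2⟩ <;> rcases hz2 with ⟨h3, h4⟩ | ⟨h3, h4⟩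
    · obtain ⟨k1, k2⟩ := key _ _ _ _ h1 h2 h3 h4
      exact hdis (Or.inl ⟨k1, min_le_left _ _⟩) (Or.inl ⟨k2, min_le_right _ _⟩)
    · obtain ⟨k1, k2⟩ := key _ _ _ _ h1 h2 h3 h4
      exact hdis (Or.inl ⟨k1, min_le_left _ _⟩) (Or.inr ⟨k2, min_le_right _ _⟩)
    · obtain ⟨k1, k2⟩ := key _ _ _ _ h1 h2 h3 h4
      exact hdis (Or.inr ⟨k1, min_le_left _ _⟩) (Or.inl ⟨k2, min_le_right _ _⟩)
    · obtain ⟨k1, k2⟩ := key _ _ _ _ h1 h2 h3 h4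
      exact hdis (Or.inr ⟨k1, min_le_left _ _⟩) (Or.inr ⟨k2, min_le_right _ _⟩)
  · exact (Finset.sum_le_sum fun i _ => hlip _ _).trans_lt hEδ

theorem LipschitzWith.comp_absolutelyContinuousOnInterval {f g : ℝ → ℝ} {a b : ℝ}
    {K : NNReal} (hg : LipschitzWith K g) (hf : AbsolutelyContinuousOnInterval f a b) :
    AbsolutelyContinuousOnInterval (fun t => g (f t)) a b := by
  have h := Tendsto.const_mul (K : ℝ) hf
  rw [mul_zero] at h
  refine squeeze_zero (fun t => ?_) (fun t => ?_) h
  · exact Finset.sum_nonneg fun i _ => dist_nonneg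
  · rw [Finset.mul_sum]
    exact Finset.sum_le_sum fun i _ => hg.dist_le_mul _ _

theorem absolutelyContinuousOnInterval_const (c a b : ℝ) :
    AbsolutelyContinuousOnInterval (fun _ => c) a b :=
  (contDiff_const (n := 1)).contDiffOn.absolutelyContinuousOnInterval

/-- The concatenation of `f` on `[0, S]` and a translate of `g` on `[0, T]`. -/
def concatCurve (S : ℝ) (f g : ℝ → ℝ) (t : ℝ) : ℝ := f (min t S) + g (max (t - S) 0) - g 0

theorem concatCurve_of_le {S t : ℝ} (f g : ℝ → ℝ) (h : t ≤ S) : concatCurve S f g t = f t := by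
  simp [concatCurve, min_eq_left h, max_eq_right (sub_nonpos.2 h)]

theorem concatCurve_of_ge {S t : ℝ} (f g : ℝ → ℝ) (h : S ≤ t) :
    concatCurve S f g t = g (t - S) + (f S - g 0) := by
  simp [concatCurve, min_eq_right h, max_eq_left (sub_nonneg.2 h)]; ring

theorem AbsolutelyContinuousOnInterval.concatCurve {f g : ℝ → ℝ} {S T : ℝ} (hS : 0 ≤ S)
    (hT : 0 ≤ T) (hf : AbsolutelyContinuousOnInterval f 0 S)
    (hg : AbsolutelyContinuousOnInterval g 0 T) :
    AbsolutelyContinuousOnInterval (concatCurve S f g) 0 (S + T) := by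
  have h1 : AbsolutelyContinuousOnInterval (fun t => f (min t S)) 0 (S + T) := by
    refine hf.comp_monotone (fun x y h => min_le_min_right _ h) (fun x y => ?_) fun x hx => ?_
    · simpa [Real.dist_eq] using abs_min_sub_min_le_max x S y S
    · rw [Set.uIcc_of_le (by positivity)] at *
      exact ⟨le_min hx.1 hS, min_le_right _ _⟩
  have h2 : AbsolutelyContinuousOnInterval (fun t => g (max (t - S) 0)) 0 (S + T) := by
    refine hg.comp_monotone (fun x y h => max_le_max_right _ (by linarith)) (fun x y => ?_)
      fun x hx => ?_
    · simpa [Real.dist_eq] using abs_max_sub_max_le_max (x - S) 0 (y - S) 0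
    · rw [Set.uIcc_of_le (by positivity)] at *
      exact ⟨le_max_right _ _, max_le (by linarith [hx.2]) hT⟩
  exact (h1.add h2).sub (absolutelyContinuousOnInterval_const (g 0) 0 (S + T))

theorem AbsolutelyContinuousOnInterval.comp_add {f : ℝ → ℝ} {a b : ℝ} (d : ℝ)
    (hf : AbsolutelyContinuousOnInterval f (a + d) (b + d)) :
    AbsolutelyContinuousOnInterval (fun t => f (t + d)) a b := by
  refine hf.comp_monotone (fun x y h => by simpa using h) (fun x y => by simp) fun x hx => ?_
  rw [← Set.image_add_const_uIcc]
  exact ⟨x, hx, rfl⟩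

/-! ### The action -/

theorem lagrangian_nonneg (U : ℝ → ℝ) (s x : ℝ) : 0 ≤ lagrangian U s x := by
  unfold lagrangian; positivity

/-- Agreement on the open interval suffices: derivatives are compared through germs, and the
endpoints, where concatenated curves may have a corner, are negligible. -/
theorem action_congr {U : ℝ → ℝ} (hper : Function.Periodic (deriv U) 1) {γ η : ℝ → ℝ}
    {a b : ℝ} (n : ℤ) (h : ∀ t ∈ Set.Ioo a b, γ t = η t + n) :
    action U γ a b = action U η a b := by
  unfold action
  rw [← setLIntegral_congr Ioo_ae_eq_Icc, ← setLIntegral_congr Ioo_ae_eq_Icc]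
  refine setLIntegral_congr_fun measurableSet_Ioo fun t ht => ?_
  have hd : deriv γ t = deriv η t := by
    have : γ =ᶠ[𝓝 t] fun r => η r + n := by
      filter_upwards [Ioo_mem_nhds ht.1 ht.2] with r hr using h r hr
    rw [this.deriv_eq, deriv_add_const]
  have hU : deriv U (γ t) = deriv U (η t) := by
    rw [h t ht]; simpa using hper.int_mul n (η t)
  simp only [lagrangian, hd, hU]

theorem action_add (U γ : ℝ → ℝ) {a b c : ℝ} (hab : a ≤ b) (hbc : b ≤ c) :
    action U γ a b + action U γ b c = action U γ a c := by
  unfold action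
  rw [← Set.Icc_union_Ioc_eq_Icc hab hbc, lintegral_union measurableSet_Ioc
    (Set.disjoint_left.2 fun x hx hx' => by linarith [hx.2, hx'.1]),
    setLIntegral_congr (Ioc_ae_eq_Icc (a := b) (b := c))]

theorem action_comp_add (U γ : ℝ → ℝ) (a b d : ℝ) :
    action U (fun t => γ (t + d)) a b = action U γ (a + d) (b + d) := by
  unfold action
  have h := (measurePreserving_add_right volume d).setLIntegral_comp_preimage_emb
    (measurableEmbedding_addRight d)
    (fun t => ENNReal.ofReal (lagrangian U (deriv γ t) (γ t))) (Set.Icc (a + d) (b + d))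
  rw [← h]
  simp [deriv_comp_add_const]

theorem action_const_of_deriv_eq_zero {U : ℝ → ℝ} {c : ℝ} (hc : deriv U c = 0) (a b : ℝ) :
    action U (fun _ => c) a b = 0 := by
  simp [action, lagrangian, hc]

theorem ofReal_integral_le_lintegral_ofReal {α : Type*} [MeasurableSpace α] {μ : Measure α}
    {f : α → ℝ} (hf : Integrable f μ) :
    ENNReal.ofReal (∫ x, f x ∂μ) ≤ ∫⁻ x, ENNReal.ofReal (f x) ∂μ := by
  refine ENNReal.ofReal_le_of_le_toReal ?_
  rw [integral_eq_lintegral_pos_part_sub_lintegral_neg_part hf]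
  simp

/-- A function `Ψ` with `Ψ' s + e ≤ L(s, ·)` along a curve bounds the action from below. -/
theorem ofReal_sub_add_le_action {U γ Ψ ψ : ℝ → ℝ} {a b e : ℝ} {K : NNReal} (hab : a ≤ b)
    (hγ : AbsolutelyContinuousOnInterval γ a b) (hΨ : ∀ x, HasDerivAt Ψ (ψ x) x)
    (hlip : LipschitzWith K Ψ)
    (hle : ∀ t ∈ Set.Icc a b, ∀ s, ψ (γ t) * s + e ≤ lagrangian U s (γ t)) :
    ENNReal.ofReal (Ψ (γ b) - Ψ (γ a) + e * (b - a)) ≤ action U γ a b := by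
  have hac := hlip.comp_absolutelyContinuousOnInterval hγ
  have hint := hac.intervalIntegrable_deriv
  have hint' : IntegrableOn (fun t => deriv (fun r => Ψ (γ r)) t + e) (Set.Icc a b) :=
    ((intervalIntegrable_iff_integrableOn_Icc_of_le hab).1 hint).add
      (integrableOn_const (by simp))
  have heq : Ψ (γ b) - Ψ (γ a) + e * (b - a)
      = ∫ t in Set.Icc a b, (deriv (fun r => Ψ (γ r)) t + e) := by
    rw [integral_Icc_eq_integral_Ioc, ← intervalIntegral.integral_of_le hab,
      intervalIntegral.integral_add hint (by simp), hac.integral_deriv_eq_sub]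
    simp; ring
  rw [heq]
  refine (ofReal_integral_le_lintegral_ofReal hint').trans ?_
  refine lintegral_mono_ae ?_
  have hd := hγ.ae_differentiableAt
  rw [Set.uIcc_of_le hab] at hd
  filter_upwards [ae_restrict_of_ae hd, ae_restrict_mem measurableSet_Icc] with t ht htm
  refine ENNReal.ofReal_le_ofReal ?_
  have : deriv (fun r => Ψ (γ r)) t = ψ (γ t) * deriv γ t :=
    ((hΨ (γ t)).comp t (ht htm).hasDerivAt).deriv
  rw [this]
  exact hle t htm _

theorem coe_intCast_unitAddCircle (n : ℤ) : ((n : ℝ) : UnitAddCircle) = 0 :=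
  (AddCircle.coe_eq_zero_iff 1).2 ⟨n, by simp⟩

/-! ### The least action on the circle -/

theorem leastAction_le_action (U : ℝ → ℝ) {γ : ℝ → ℝ} {a b : ℝ}
    (hγ : AbsolutelyContinuousOnInterval γ a b) :
    leastAction U (b - a) (γ b) (γ a) ≤ action U γ a b := by
  have h := action_comp_add U γ 0 (b - a) a
  rw [zero_add, sub_add_cancel] at h
  rw [← h]
  refine iInf₂_le_of_le (fun t => γ (t + a)) ?_ (iInf₂_le_of_le ?_ ?_ le_rfl)
  · exact AbsolutelyContinuousOnInterval.comp_add a (by simpa using hγ)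
  · simp
  · simp

theorem leastAction_add_le {U : ℝ → ℝ} (hper : Function.Periodic (deriv U) 1) {S T : ℝ}
    (hS : 0 ≤ S) (hT : 0 ≤ T) (x y z : UnitAddCircle) :
    leastAction U (S + T) z x ≤ leastAction U S y x + leastAction U T z y := by
  have key : ∀ f g : ℝ → ℝ, AbsolutelyContinuousOnInterval f 0 S →
      AbsolutelyContinuousOnInterval g 0 T → (f 0 : UnitAddCircle) = x →
      (f S : UnitAddCircle) = y → (g 0 : UnitAddCircle) = y → (g T : UnitAddCircle) = z →
      leastAction U (S + T) z x ≤ action U f 0 S + action U g 0 T := by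
    intro f g hf hg h1 h2 h3 h4
    -- The two lifts meet only modulo 1. The second is translated by this integer, which leaves its
    -- action unchanged.
    obtain ⟨n, hn⟩ : ∃ n : ℤ, (n : ℝ) = f S - g 0 := by
      have h : ((f S - g 0 : ℝ) : UnitAddCircle) = 0 := by simp [h2, h3]
      obtain ⟨n, hn⟩ := (AddCircle.coe_eq_zero_iff 1).1 h
      exact ⟨n, by simpa using hn⟩
    refine iInf₂_le_of_le (concatCurve S f g) (hf.concatCurve hS hT hg)
      (iInf₂_le_of_le ?_ ?_ ?_)
    · rw [concatCurve_of_le _ _ hS, h1]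
    · rw [concatCurve_of_ge _ _ (by linarith), AddCircle.coe_add, ← hn,
        coe_intCast_unitAddCircle, add_zero]
      simpa using h4
    · rw [← action_add U _ hS (by linarith : S ≤ S + T)]
      refine le_of_eq (congrArg₂ _ ?_ ?_)
      · exact action_congr hper 0 fun t ht => by simp [concatCurve_of_le f g ht.2.le]
      · have := action_comp_add U (concatCurve S f g) 0 T S
        rw [zero_add, add_comm T S] at this
        rw [← this]
        refine action_congr hper n fun t ht => ?_
        rw [concatCurve_of_ge _ _ (by linarith [ht.1]), hn]; simp
  conv_rhs => unfold leastAction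
  simp only [ENNReal.iInf_add, ENNReal.add_iInf]
  exact le_iInf₂ fun g hg => le_iInf₂ fun h3 h4 => le_iInf₂ fun f hf => le_iInf₂ fun h1 h2 =>
    key f g hf hg h1 h2 h3 h4

theorem leastAction_self_of_deriv_eq_zero {U : ℝ → ℝ} {c : ℝ} (hc : deriv U c = 0) (T : ℝ) :
    leastAction U T (c : UnitAddCircle) c = 0 := by
  have h := leastAction_le_action U (absolutelyContinuousOnInterval_const c 0 T)
  rw [action_const_of_deriv_eq_zero hc, sub_zero] at h
  exact le_antisymm h bot_le

/-- Spare time can be spent at the equilibrium `c` at no cost. -/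
theorem antitone_leastAction {U : ℝ → ℝ} (hper : Function.Periodic (deriv U) 1) {c : ℝ}
    (hc : deriv U c = 0) (y : UnitAddCircle) {S T : ℝ} (hS : 0 ≤ S) (hST : S ≤ T) :
    leastAction U T y c ≤ leastAction U S y c := by
  have h := leastAction_add_le hper (sub_nonneg.2 hST) hS (c : UnitAddCircle) c y
  rwa [leastAction_self_of_deriv_eq_zero hc, zero_add, sub_add_cancel] at h

/-- From an equilibrium, the Peierls barrier is the least action in free time. -/
theorem peierlsBarrier_eq_iInf {U : ℝ → ℝ} (hper : Function.Periodic (deriv U) 1) {c : ℝ}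
    (hc : deriv U c = 0) (y : UnitAddCircle) :
    peierlsBarrier U y c = ⨅ (T : ℝ) (_ : 0 ≤ T), leastAction U T y c := by
  refine le_antisymm (le_iInf₂ fun T hT => ?_) ?_
  · refine liminf_le_of_frequently_le' (Eventually.frequently ?_)
    filter_upwards [eventually_ge_atTop T] with S hS using antitone_leastAction hper hc y hT hS
  · refine le_liminf_of_le (by isBoundedDefault) ?_
    filter_upwards [eventually_ge_atTop 0] with S hS using iInf₂_le S hS

/-! ### Minima of barriers -/

/-- The function `min_j (B_j + h(x; m_j))`, with values in `[0, ∞]`. -/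
def minBarrier (U : ℝ → ℝ) (s : Finset ℤ) (B : ℤ → ℝ≥0∞) (m : ℤ → ℝ) (x : UnitAddCircle) :
    ℝ≥0∞ :=
  ⨅ j ∈ s, (B j + peierlsBarrier U x (m j : UnitAddCircle))

theorem minBarrier_le_add_action {U : ℝ → ℝ} (hper : Function.Periodic (deriv U) 1)
    {s : Finset ℤ} {B : ℤ → ℝ≥0∞} {m : ℤ → ℝ} (hm : ∀ i, deriv U (m i) = 0)
    {j : ℤ} (hj : j ∈ s) {γ : ℝ → ℝ} {T : ℝ} (hT : 0 ≤ T)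
    (hγ : AbsolutelyContinuousOnInterval γ 0 T) (h0 : (γ 0 : UnitAddCircle) = m j) :
    minBarrier U s B m (γ T) ≤ B j + action U γ 0 T := by
  refine iInf₂_le_of_le j hj ?_
  gcongr
  rw [peierlsBarrier_eq_iInf hper (hm j)]
  refine iInf₂_le_of_le T hT ?_
  have := leastAction_le_action U hγ
  rwa [h0, sub_zero] at this

theorem exists_curve_of_minBarrier_lt {U : ℝ → ℝ} (hper : Function.Periodic (deriv U) 1)
    {s : Finset ℤ} {B : ℤ → ℝ≥0∞} {m : ℤ → ℝ} (hm : ∀ i, deriv U (m i) = 0)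
    {x : UnitAddCircle} {c : ℝ≥0∞} (h : minBarrier U s B m x < c) :
    ∃ j ∈ s, ∃ (T : ℝ) (γ : ℝ → ℝ), 0 ≤ T ∧ AbsolutelyContinuousOnInterval γ 0 T ∧
      (γ 0 : UnitAddCircle) = m j ∧ (γ T : UnitAddCircle) = x ∧ B j + action U γ 0 T < c := by
  simp only [minBarrier, iInf_lt_iff] at h
  obtain ⟨j, hj, h⟩ := h
  have h' := lt_tsub_iff_right.2 ((add_comm _ _).trans_lt h)
  rw [peierlsBarrier_eq_iInf hper (hm j)] at h'
  simp only [leastAction, iInf_lt_iff] at h'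
  obtain ⟨T, hT, γ, hγ, h0, h1, hlt⟩ := h'
  exact ⟨j, hj, T, γ, hT, hγ, h0, h1,
    (add_comm _ _).trans_lt (lt_tsub_iff_right.1 hlt)⟩

/-- Appending `γ` to a competitor for `γ a` gives one for `γ b`. This domination is one half of
calibration. -/
theorem minBarrier_le_minBarrier_add_action {U : ℝ → ℝ}
    (hper : Function.Periodic (deriv U) 1)
    {s : Finset ℤ} {B : ℤ → ℝ≥0∞} {m : ℤ → ℝ} (hm : ∀ i, deriv U (m i) = 0)
    {γ : ℝ → ℝ} {a b : ℝ} (hab : a ≤ b) (hγ : AbsolutelyContinuousOnInterval γ a b) :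
    minBarrier U s B m (γ b) ≤ minBarrier U s B m (γ a) + action U γ a b := by
  unfold minBarrier
  simp only [ENNReal.iInf_add]
  refine iInf₂_mono fun j hj => ?_
  rw [add_assoc, peierlsBarrier_eq_iInf hper (hm j), peierlsBarrier_eq_iInf hper (hm j)]
  gcongr
  simp only [ENNReal.iInf_add]
  refine le_iInf₂ fun T hT => iInf₂_le_of_le (T + (b - a)) (by linarith) ?_
  refine (leastAction_add_le hper hT (sub_nonneg.2 hab) _ (γ a) _).trans ?_
  gcongr
  exact leastAction_le_action U hγ

theorem exists_curve_action_lt_top {U : ℝ → ℝ} (hU : Continuous (deriv U)) (x y : ℝ) :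
    ∃ γ : ℝ → ℝ, AbsolutelyContinuousOnInterval γ 0 1 ∧ γ 0 = x ∧ γ 1 = y ∧
      action U γ 0 1 < ⊤ := by
  have hd : ∀ t, HasDerivAt (fun t : ℝ => x + t * (y - x)) (y - x) t := fun t => by
    simpa using ((hasDerivAt_id t).mul_const (y - x)).const_add x
  refine ⟨fun t => x + t * (y - x), ?_, by simp, by simp, ?_⟩
  · have : ContDiff ℝ 1 fun t : ℝ => x + t * (y - x) := by fun_prop
    exact this.contDiffOn.absolutelyContinuousOnInterval
  · refine Integrable.lintegral_lt_top ?_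
    refine Continuous.integrableOn_Icc ?_
    simp only [lagrangian, (hd _).deriv]
    fun_prop

theorem coverBarrier_lt_top {U : ℝ → ℝ} (hU : Continuous (deriv U)) (x y : ℝ) :
    coverBarrier U y x < ⊤ := by
  obtain ⟨γ, hγ, h0, h1, h⟩ := exists_curve_action_lt_top hU x y
  exact lt_of_le_of_lt (iInf₂_le_of_le 1 γ <| iInf₂_le_of_le zero_le_one hγ <|
    iInf₂_le_of_le h0 h1 le_rfl) h

theorem boundaryValue_lt_top {U : ℝ → ℝ} (hU : Continuous (deriv U)) {k : ℕ} (hk : 1 ≤ k)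
    (m : ℤ → ℝ) (i : ℤ) : boundaryValue U k m i < ⊤ := by
  have h1 : (1 : ℤ) ∈ Finset.Icc (1 : ℤ) k := by simp; omega
  refine lt_of_le_of_lt (iInf₂_le 1 h1) (ENNReal.add_lt_top.2 ⟨?_, ?_⟩)
  · unfold ccwCost; split_ifs <;> exact coverBarrier_lt_top hU _ _
  · unfold cwCost; split_ifs <;> exact coverBarrier_lt_top hU _ _

theorem minBarrier_lt_top {U : ℝ → ℝ} (hper : Function.Periodic (deriv U) 1)
    (hU : Continuous (deriv U)) {s : Finset ℤ} {B : ℤ → ℝ≥0∞} {m : ℤ → ℝ}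
    (hm : ∀ i, deriv U (m i) = 0) {j : ℤ} (hj : j ∈ s) (hB : B j < ⊤) (x : UnitAddCircle) :
    minBarrier U s B m x < ⊤ := by
  obtain ⟨y, rfl⟩ := QuotientAddGroup.mk_surjective x
  obtain ⟨γ, hγ, h0, h1, h⟩ := exists_curve_action_lt_top hU (m j) y
  have := minBarrier_le_add_action (B := B) hper hm hj zero_le_one hγ (by rw [h0])
  rw [h1] at this
  exact this.trans_lt (ENNReal.add_lt_top.2 ⟨hB, h⟩)

/-! ### Calibrated curves -/

theorem ContDiff.piecewiseC1On {γ : ℝ → ℝ} (hγ : ContDiff ℝ 1 γ) {a b : ℝ} (hab : a ≤ b) :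
    PiecewiseC1On γ a b := by
  refine ⟨hγ.continuous.continuousOn, 1, fun n => if n = 0 then a else b, ?_, by simp, by simp,
    fun i _ => hγ.contDiffOn⟩
  refine monotone_nat_of_le_succ fun n => ?_
  by_cases h : n = 0 <;> simp [h, hab]

/-- A curve along which `L = Ψ' γ'` and along which the increment of `Ψ` from any past time to
time `0` is at most the increment of the minimum of barriers is calibrated. -/
theorem isCalibratedCurve_minBarrier {U : ℝ → ℝ} (hper : Function.Periodic (deriv U) 1)
    {s : Finset ℤ} {B : ℤ → ℝ≥0∞} {m : ℤ → ℝ} (hm : ∀ i, deriv U (m i) = 0)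
    (hfin : ∀ x, minBarrier U s B m x < ⊤) {γ Ψ ψ : ℝ → ℝ} (hγ : ContDiff ℝ 1 γ)
    (hΨ : ∀ x, HasDerivAt Ψ (ψ x) x) (hψ : Continuous ψ)
    (hL : ∀ t, lagrangian U (deriv γ t) (γ t) = ψ (γ t) * deriv γ t)
    (hW : ∀ t ≤ 0, minBarrier U s B m (γ t) + ENNReal.ofReal (Ψ (γ 0) - Ψ (γ t))
      ≤ minBarrier U s B m (γ 0)) :
    IsCalibratedCurve U (fun x => (minBarrier U s B m x).toReal) γ := by
  refine ⟨fun a ha => hγ.piecewiseC1On ha, fun a b hab hb => ?_⟩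
  have hcd : Continuous (deriv γ) := hγ.continuous_deriv le_rfl
  have hint : ∀ a b : ℝ, ∫ t in a..b, lagrangian U (deriv γ t) (γ t) = Ψ (γ b) - Ψ (γ a) := by
    intro a b
    simp only [hL]
    refine intervalIntegral.integral_eq_sub_of_hasDerivAt (f := fun t => Ψ (γ t))
      (fun t _ => ?_) ?_
    · exact (hΨ (γ t)).comp t ((hγ.differentiable one_ne_zero) t).hasDerivAt
    · exact ((hψ.comp hγ.continuous).mul hcd).intervalIntegrable _ _
  have hmono : ∀ a b : ℝ, a ≤ b → 0 ≤ Ψ (γ b) - Ψ (γ a) := fun a b hab => by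
    rw [← hint]
    exact intervalIntegral.integral_nonneg hab fun t _ => lagrangian_nonneg _ _ _
  have hact : ∀ a b : ℝ, a ≤ b → action U γ a b = ENNReal.ofReal (Ψ (γ b) - Ψ (γ a)) := by
    intro a b hab
    rw [← hint, intervalIntegral.integral_of_le hab, ← integral_Icc_eq_integral_Ioc,
      ofReal_integral_eq_lintegral_ofReal, action]
    · refine Continuous.integrableOn_Icc ?_
      simp only [hL]
      exact (hψ.comp hγ.continuous).mul hcd
    · exact ae_of_all _ fun t => lagrangian_nonneg _ _ _
  have hdom : ∀ a b : ℝ, a ≤ b → (minBarrier U s B m (γ b)).toReal ≤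
      (minBarrier U s B m (γ a)).toReal + (Ψ (γ b) - Ψ (γ a)) := by
    intro a b hab
    have h := minBarrier_le_minBarrier_add_action (s := s) (B := B) hper hm hab
      hγ.contDiffOn.absolutelyContinuousOnInterval
    rw [hact a b hab] at h
    have h' := ENNReal.toReal_mono
      (ENNReal.add_lt_top.2 ⟨hfin _, ENNReal.ofReal_lt_top⟩).ne h
    rwa [ENNReal.toReal_add (hfin _).ne ENNReal.ofReal_ne_top,
      ENNReal.toReal_ofReal (hmono a b hab)] at h'
  -- Domination on `[a, b]` and on `[b, 0]` adds up to the reverse of the bound `hW` on `[a, 0]`, so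
  -- all three are equalities.
  have h1 := hdom a b hab.le
  have h2 := hdom b 0 hb
  have h3 := ENNReal.toReal_mono (hfin _).ne (hW a (hab.le.trans hb))
  rw [ENNReal.toReal_add (hfin _).ne ENNReal.ofReal_ne_top,
      ENNReal.toReal_ofReal (hmono a 0 (hab.le.trans hb))] at h3
  rw [hint]
  linarith

/-! ### Scalar autonomous differential equations -/

theorem LipschitzWith.ode_solution_unique {v : ℝ → ℝ} {K : NNReal} (hv : LipschitzWith K v)
    {γ η : ℝ → ℝ} (hγ : ∀ t, HasDerivAt γ (v (γ t)) t) (hη : ∀ t, HasDerivAt η (v (η t)) t)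
    {t₀ : ℝ} (h : γ t₀ = η t₀) : γ = η :=
  ODE_solution_unique_univ (v := fun _ => v) (s := fun _ => Set.univ)
    (fun _ => hv.lipschitzOnWith) (fun t => ⟨hγ t, trivial⟩) (fun t => ⟨hη t, trivial⟩) h

/-- A bounded field lets Picard-Lindelöf run on every `[-N, N]`; the local solutions agree by
uniqueness and are glued. -/
theorem LipschitzWith.exists_ode_solution {v : ℝ → ℝ} {K C : NNReal} (hv : LipschitzWith K v)
    (hC : ∀ x, ‖v x‖ ≤ C) (x : ℝ) :
    ∃ γ : ℝ → ℝ, γ 0 = x ∧ ∀ t, HasDerivAt γ (v (γ t)) t := by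
  have hloc : ∀ N : ℝ, ∃ γ : ℝ → ℝ, γ 0 = x ∧
      ∀ t ∈ Set.Ioo (-N) N, HasDerivAt γ (v (γ t)) t := by
    intro N
    rcases le_or_gt N 0 with hN | hN
    · exact ⟨fun _ => x, rfl, fun t ht => by linarith [ht.1, ht.2]⟩
    have hpl : IsPicardLindelof (fun _ => v) (tmin := -N) (tmax := N)
        ⟨0, by constructor <;> linarith⟩ x (C * N.toNNReal) 0 C K := by
      refine IsPicardLindelof.of_time_independent (fun y _ => hC y) hv.lipschitzOnWith ?_
      simp [Real.coe_toNNReal _ hN.le]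
    obtain ⟨γ, h0, h⟩ := hpl.exists_eq_forall_mem_Icc_hasDerivWithinAt₀
    exact ⟨γ, h0, fun t ht =>
      (h t (Set.Ioo_subset_Icc_self ht)).hasDerivAt (Icc_mem_nhds ht.1 ht.2)⟩
  choose α h0 hα using hloc
  have huniq : ∀ N M : ℝ, 0 < N → N ≤ M → Set.EqOn (α N) (α M) (Set.Ioo (-N) N) := by
    intro N M hN hNM
    refine ODE_solution_unique_of_mem_Ioo (v := fun _ => v) (s := fun _ => Set.univ) (K := K)
      (t₀ := 0) (fun _ _ => hv.lipschitzOnWith) ⟨by linarith, hN⟩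
      (fun t ht => ⟨hα N t ht, trivial⟩) (fun t ht => ⟨hα M t ?_, trivial⟩)
      ((h0 N).trans (h0 M).symm)
    exact ⟨by linarith [ht.1], by linarith [ht.2]⟩
  have hmem : ∀ t : ℝ, t ∈ Set.Ioo (-(|t| + 1)) (|t| + 1) := fun t =>
    ⟨by linarith [neg_abs_le t], by linarith [le_abs_self t]⟩
  refine ⟨fun t => α (|t| + 1) t, h0 _, fun t => ?_⟩
  refine (hα _ t (hmem t)).congr_of_eventuallyEq ?_
  filter_upwards [Ioo_mem_nhds (hmem t).1 (hmem t).2] with r hr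
  rcases le_total (|r| + 1) (|t| + 1) with h | h
  · exact huniq _ _ (by positivity) h (hmem r)
  · exact (huniq _ _ (by positivity) h hr).symm

/-- A bounded limit of a trajectory is an equilibrium. -/
theorem eq_zero_of_tendsto_ode_solution {v γ : ℝ → ℝ} (hv : Continuous v)
    (hγ : ∀ t, HasDerivAt γ (v (γ t)) t) {c : ℝ} (h : Tendsto γ atBot (𝓝 c)) : v c = 0 := by
  -- By the mean value theorem the increments over unit time, which tend to 0, are values of `v`
  -- along the trajectory, which tend to `v c`.
  have hmv : ∀ t : ℝ, ∃ r ∈ Set.Ioo t (t + 1), v (γ r) = γ (t + 1) - γ t := by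
    intro t
    obtain ⟨r, hr, h⟩ := exists_hasDerivAt_eq_slope γ (fun r => v (γ r)) (lt_add_one t)
      (fun r _ => (hγ r).continuousAt.continuousWithinAt) (fun r _ => hγ r)
    exact ⟨r, hr, by simpa using h⟩
  choose r hr hvr using hmv
  have hr' : Tendsto r atBot atBot :=
    tendsto_atBot_mono (fun t => (hr t).2.le) (tendsto_atBot_add_const_right _ 1 tendsto_id)
  have h1 : Tendsto (fun t => v (γ (r t))) atBot (𝓝 (v c)) :=
    (hv.tendsto c).comp (h.comp hr')
  have h2 : Tendsto (fun t => v (γ (r t))) atBot (𝓝 (c - c)) := by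
    simp only [hvr]
    exact (h.comp (tendsto_atBot_add_const_right _ 1 tendsto_id)).sub h
  rw [sub_self] at h2
  exact tendsto_nhds_unique h1 h2

/-- A trajectory that starts off the equilibria never meets one. -/
theorem LipschitzWith.ode_solution_ne {v : ℝ → ℝ} {K : NNReal} (hv : LipschitzWith K v)
    {γ : ℝ → ℝ} (hγ : ∀ t, HasDerivAt γ (v (γ t)) t) {t₀ : ℝ} (h₀ : v (γ t₀) ≠ 0) (t : ℝ) :
    v (γ t) ≠ 0 := by
  intro h
  have := hv.ode_solution_unique (η := fun _ => γ t) hγ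
    (fun r => by rw [h]; exact hasDerivAt_const r _) (t₀ := t) rfl
  exact h₀ (by rw [this]; exact h)

theorem ode_solution_lt_iff {v γ : ℝ → ℝ} (hγ : ∀ t, HasDerivAt γ (v (γ t)) t)
    (hne : ∀ t, v (γ t) ≠ 0) {c : ℝ} (hc : v c = 0) (s t : ℝ) : c < γ s ↔ c < γ t := by
  have hcont : Continuous γ := continuous_iff_continuousAt.2 fun t => (hγ t).continuousAt
  have hcn : ∀ t, γ t ≠ c := fun t h => hne t (h ▸ hc)
  have key : ∀ s t, c < γ s → c < γ t := by
    intro s t hs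
    by_contra hlt
    obtain ⟨r, hr⟩ := mem_range_of_exists_le_of_exists_ge hcont ⟨t, not_lt.1 hlt⟩ ⟨s, hs.le⟩
    exact hcn r hr
  exact ⟨key s t, key t s⟩

theorem ode_solution_pos_of_pos {v γ : ℝ → ℝ} (hv : Continuous v)
    (hγ : ∀ t, HasDerivAt γ (v (γ t)) t)
    (hne : ∀ t, v (γ t) ≠ 0) {s : ℝ} (hs : 0 < v (γ s)) (t : ℝ) : 0 < v (γ t) := by
  have hcont : Continuous γ := continuous_iff_continuousAt.2 fun t => (hγ t).continuousAt
  by_contra hlt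
  obtain ⟨r, hr⟩ := mem_range_of_exists_le_of_exists_ge (hv.comp hcont)
    ⟨t, not_lt.1 hlt⟩ ⟨s, hs.le⟩
  exact hne r hr

theorem contDiff_two_of_ode {v γ : ℝ → ℝ} (hv : ContDiff ℝ 1 v)
    (hγ : ∀ t, HasDerivAt γ (v (γ t)) t) : ContDiff ℝ 2 γ := by
  have hd : deriv γ = fun t => v (γ t) := funext fun t => (hγ t).deriv
  have hdiff : Differentiable ℝ γ := fun t => (hγ t).differentiableAt
  have h1 : ContDiff ℝ 1 γ :=
    contDiff_one_iff_deriv.2 ⟨hdiff, by rw [hd]; exact hv.continuous.comp hdiff.continuous⟩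
  rw [show (2 : WithTop ℕ∞) = 1 + 1 by norm_num, contDiff_succ_iff_deriv]
  exact ⟨hdiff, by simp, by rw [hd]; exact hv.comp h1⟩

/-! ### Periodic functions and their primitives -/

theorem Function.Periodic.exists_norm_le {v : ℝ → ℝ} (hper : Function.Periodic v 1)
    (hv : Continuous v) : ∃ C : NNReal, ∀ x, ‖v x‖ ≤ C := by
  obtain ⟨C, hC⟩ := (isCompact_Icc (a := (0 : ℝ)) (b := 1)).exists_bound_of_continuousOn
    hv.continuousOn
  refine ⟨C.toNNReal, fun x => ?_⟩
  obtain ⟨y, hy, hxy⟩ := hper.exists_mem_Ico₀ one_pos x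
  rw [hxy]
  exact (hC y (Set.Ico_subset_Icc_self hy)).trans (Real.le_coe_toNNReal C)

theorem Function.Periodic.exists_lipschitzWith {v : ℝ → ℝ} (hper : Function.Periodic v 1)
    (hv : ContDiff ℝ 1 v) : ∃ K : NNReal, LipschitzWith K v := by
  have hper' : Function.Periodic (deriv v) 1 := fun x => by
    rw [← deriv_comp_add_const, show (fun y => v (y + 1)) = v from funext hper]
  obtain ⟨K, hK⟩ := hper'.exists_norm_le (hv.continuous_deriv le_rfl)
  exact ⟨K, lipschitzWith_of_nnnorm_deriv_le (hv.differentiable one_ne_zero) hK⟩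

theorem exists_lipschitz_primitive {ψ : ℝ → ℝ} (hψ : Continuous ψ) {C : NNReal}
    (hC : ∀ x, ‖ψ x‖ ≤ C) :
    ∃ Ψ : ℝ → ℝ, (∀ x, HasDerivAt Ψ (ψ x) x) ∧ LipschitzWith C Ψ := by
  have hd : ∀ x, HasDerivAt (fun x => ∫ t in (0 : ℝ)..x, ψ t) (ψ x) x := fun x =>
    intervalIntegral.integral_hasDerivAt_right (hψ.intervalIntegrable _ _)
      (hψ.stronglyMeasurableAtFilter _ _) hψ.continuousAt
  exact ⟨_, hd, lipschitzWith_of_nnnorm_deriv_le (fun x => (hd x).differentiableAt)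
    fun x => by rw [(hd x).deriv]; exact hC x⟩

/-- The primitive need not be periodic, but its increments do not depend on the lift. -/
theorem Function.Periodic.primitive_add_int_sub {Ψ ψ : ℝ → ℝ} (hper : Function.Periodic ψ 1)
    (hΨ : ∀ x, HasDerivAt Ψ (ψ x) x) (n : ℤ) (x y : ℝ) :
    Ψ (x + n) - Ψ (y + n) = Ψ x - Ψ y := by
  have hd : ∀ x, HasDerivAt (fun x => Ψ (x + n) - Ψ x) 0 x := fun x => by
    have h := ((hΨ (x + n)).comp_add_const x n).sub (hΨ x)
    have hx : ψ (x + n) = ψ x := by simpa using hper.int_mul n x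
    rwa [hx, sub_self] at h
  have := is_const_of_deriv_eq_zero (fun x => (hd x).differentiableAt) (fun x => (hd x).deriv)
    x y
  linarith

/-- With `a = U' x`, `L - a s = (s - a)² / 4` and `L - 0 * s = (s + a)² / 4`. Equality holds at `s =
|a|`, and in the companion bound with `min` at `s = -|a|`. -/
theorem max_mul_le_lagrangian (U : ℝ → ℝ) (s x : ℝ) :
    max (deriv U x) 0 * s ≤ lagrangian U s x := by
  unfold lagrangian
  rcases max_cases (deriv U x) 0 with ⟨h, _⟩ | ⟨h, _⟩ <;> rw [h] <;>
    nlinarith [sq_nonneg (s - deriv U x), sq_nonneg (s + deriv U x)]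

theorem min_mul_le_lagrangian (U : ℝ → ℝ) (s x : ℝ) :
    min (deriv U x) 0 * s ≤ lagrangian U s x := by
  unfold lagrangian
  rcases min_cases (deriv U x) 0 with ⟨h, _⟩ | ⟨h, _⟩ <;> rw [h] <;>
    nlinarith [sq_nonneg (s - deriv U x), sq_nonneg (s + deriv U x)]

theorem Function.Periodic.exists_int_add_le {v : ℝ → ℝ} (hper : Function.Periodic v 1) {c : ℝ}
    (hc : v c = 0) (x : ℝ) : (∃ d ≤ x, v d = 0) ∧ ∃ d ≥ x, v d = 0 := by
  have h : ∀ n : ℤ, v (c + n) = 0 := fun n => by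
    rw [← hc]; simpa using hper.int_mul n c
  exact ⟨⟨c + ⌊x - c⌋, by linarith [Int.floor_le (x - c)], h _⟩,
    ⟨c + ⌈x - c⌉, by linarith [Int.le_ceil (x - c)], h _⟩⟩

/-! ### Backward calibrated curves of a minimum of barriers -/

theorem exists_int_of_coe_eq {x y : ℝ} (h : (x : UnitAddCircle) = y) : ∃ n : ℤ, x = y + n := by
  have h : ((x - y : ℝ) : UnitAddCircle) = 0 := by simp [h]
  obtain ⟨n, hn⟩ := (AddCircle.coe_eq_zero_iff 1).1 h
  exact ⟨n, by simp at hn; linarith⟩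

/-- A curve to `x` that crosses (a translate of) `y` bounds the increment of the minimum of
barriers between `y` and `x`. -/
theorem minBarrier_add_ofReal_le_of_mem_uIcc {U : ℝ → ℝ} (hper : Function.Periodic (deriv U) 1)
    {s : Finset ℤ} {B : ℤ → ℝ≥0∞} {m : ℤ → ℝ} (hm : ∀ i, deriv U (m i) = 0)
    {Ψ ψ : ℝ → ℝ} {K : NNReal} (hΨ : ∀ x, HasDerivAt Ψ (ψ x) x) (hlip : LipschitzWith K Ψ)
    (hψ : Function.Periodic ψ 1) (hle : ∀ s x, ψ x * s ≤ lagrangian U s x)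
    {j : ℤ} (hj : j ∈ s) {η : ℝ → ℝ} {T : ℝ} (hT : 0 ≤ T)
    (hη : AbsolutelyContinuousOnInterval η 0 T) (h0 : (η 0 : UnitAddCircle) = m j)
    {x y : ℝ} {n : ℤ} (hx : η T = x + n) (hy : y + n ∈ Set.uIcc (η 0) (η T)) :
    minBarrier U s B m y + ENNReal.ofReal (Ψ x - Ψ y) ≤ B j + action U η 0 T := by
  obtain ⟨τ, hτ, hτy⟩ := intermediate_value_uIcc hη.continuousOn hy
  have hτ' := hτ
  rw [Set.uIcc_of_le hT] at hτ'
  have h1 := minBarrier_le_add_action (B := B) hper hm hj hτ'.1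
    (hη.mono (Set.uIcc_subset_uIcc_left hτ)) h0
  have h2 := ofReal_sub_add_le_action (U := U) (e := 0) hτ'.2
    (hη.mono (Set.uIcc_subset_uIcc_right hτ)) hΨ hlip (fun t _ s => by simpa using hle s (η t))
  rw [← action_add U η hτ'.1 hτ'.2, ← add_assoc]
  rw [hτy, AddCircle.coe_add, coe_intCast_unitAddCircle, add_zero] at h1
  rw [hτy, hx, hψ.primitive_add_int_sub hΨ, zero_mul, add_zero] at h2
  exact add_le_add h1 h2

/-- `P` and `Q` hold points to the left and right of `x` with no critical point separating them from
`x`. The side must be the same for all points of the set, so a failure on each side is refuted by a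
single curve `η` cheaper than both bounds. -/
theorem minBarrier_left_or_right {U : ℝ → ℝ} (hper : Function.Periodic (deriv U) 1)
    {s : Finset ℤ} {B : ℤ → ℝ≥0∞} {m : ℤ → ℝ} (hm : ∀ i, deriv U (m i) = 0)
    {Ψp ψp Ψm ψm : ℝ → ℝ} {Kp Km : NNReal}
    (hΨp : ∀ x, HasDerivAt Ψp (ψp x) x) (hlipp : LipschitzWith Kp Ψp)
    (hψp : Function.Periodic ψp 1) (hlep : ∀ s x, ψp x * s ≤ lagrangian U s x)
    (hΨm : ∀ x, HasDerivAt Ψm (ψm x) x) (hlipm : LipschitzWith Km Ψm)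
    (hψm : Function.Periodic ψm 1) (hlem : ∀ s x, ψm x * s ≤ lagrangian U s x)
    {x : ℝ} {P Q : Set ℝ}
    (hP : ∀ y ∈ P, y ≤ x ∧ ∀ c, deriv U c = 0 → c ≤ x → c ≤ y)
    (hQ : ∀ y ∈ Q, x ≤ y ∧ ∀ c, deriv U c = 0 → x ≤ c → y ≤ c) :
    (∀ y ∈ P, minBarrier U s B m y + ENNReal.ofReal (Ψp x - Ψp y) ≤ minBarrier U s B m x) ∨
    (∀ y ∈ Q, minBarrier U s B m y + ENNReal.ofReal (Ψm x - Ψm y) ≤ minBarrier U s B m x) := by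
  by_contra! h
  obtain ⟨⟨y, hy, h1⟩, z, hz, h2⟩ := h
  obtain ⟨j, hj, T, η, hT, hη, h0, hηT, hlt⟩ :=
    exists_curve_of_minBarrier_lt hper hm (lt_min h1 h2)
  obtain ⟨n, hn⟩ := exists_int_of_coe_eq hηT
  obtain ⟨l, hl⟩ := exists_int_of_coe_eq h0
  -- Translated to end at `x`, the curve starts at a critical point, hence beyond `y` or beyond `z`.
  -- It crosses one of them, whatever its detours.
  have hcrit : deriv U (η 0 - n) = 0 := by
    rw [hl, ← hm j]
    have := hper.int_mul (l - n) (m j)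
    push_cast at this
    rw [← this]; congr 1; ring
  rcases le_total (η 0) (η T) with h | h
  · refine (hlt.trans_le (min_le_left _ _)).not_ge ?_
    refine minBarrier_add_ofReal_le_of_mem_uIcc hper hm hΨp hlipp hψp hlep hj hT hη h0 hn ?_
    rw [Set.uIcc_of_le h]
    have := (hP y hy).2 _ hcrit (by linarith)
    exact ⟨by linarith, by linarith [(hP y hy).1]⟩
  · refine (hlt.trans_le (min_le_right _ _)).not_ge ?_
    refine minBarrier_add_ofReal_le_of_mem_uIcc hper hm hΨm hlipm hψm hlem hj hT hη h0 hn ?_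
    rw [Set.uIcc_of_ge h]
    have := (hQ z hz).2 _ hcrit (by linarith)
    exact ⟨by linarith [(hQ z hz).1], by linarith⟩

theorem exists_calibratedCurve_minBarrier {U : ℝ → ℝ} (hper : Function.Periodic (deriv U) 1)
    (hU : ContDiff ℝ 1 (deriv U)) {s : Finset ℤ} {B : ℤ → ℝ≥0∞} {m : ℤ → ℝ}
    (hm : ∀ i, deriv U (m i) = 0) (hfin : ∀ x, minBarrier U s B m x < ⊤) (x : ℝ) :
    ∃ γ : ℝ → ℝ, γ 0 = x ∧ IsCalibratedCurve U (fun x => (minBarrier U s B m x).toReal) γ ∧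
      ((∀ t, HasDerivAt γ (deriv U (γ t)) t) ∨ (∀ t, HasDerivAt γ (-deriv U (γ t)) t)) ∧
      ∃ c : ℝ, deriv U c = 0 ∧ Tendsto γ atBot (𝓝 c) := by
  by_cases hx : deriv U x = 0
  · refine ⟨fun _ => x, rfl, ?_, Or.inl fun t => by rw [hx]; exact hasDerivAt_const t x, x, hx,
      tendsto_const_nhds⟩
    exact isCalibratedCurve_minBarrier hper hm hfin (Ψ := 0) (ψ := 0) contDiff_const
      (fun x => hasDerivAt_const x 0) continuous_const (by simp [lagrangian, hx]) (by simp)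
  obtain ⟨C, hC⟩ := hper.exists_norm_le hU.continuous
  obtain ⟨K, hK⟩ := hper.exists_lipschitzWith hU
  -- The sign is chosen so that `w = |U'|` between the critical points around `x`: the solution `φ`
  -- of `φ' = w φ` reaches `x` from the left, its time reversal from the right.
  obtain ⟨w, hw, hwx⟩ : ∃ w : ℝ → ℝ, (w = deriv U ∨ w = fun x => -deriv U x) ∧ 0 < w x := by
    rcases lt_or_gt_of_ne hx with h | h
    · exact ⟨_, Or.inr rfl, neg_pos.2 h⟩
    · exact ⟨_, Or.inl rfl, h⟩
  have hwK : LipschitzWith K w := by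
    rcases hw with rfl | rfl
    exacts [hK, hK.neg]
  have hwC : ∀ x, ‖w x‖ ≤ C := by
    rcases hw with rfl | rfl
    exacts [hC, fun x => (norm_neg _).trans_le (hC x)]
  have hw0 : ∀ x, w x = 0 ↔ deriv U x = 0 := by
    rcases hw with rfl | rfl <;> simp
  have hw1 : ContDiff ℝ 1 w := by
    rcases hw with rfl | rfl
    exacts [hU, hU.neg]
  obtain ⟨φ, hφ0, hφ⟩ := hwK.exists_ode_solution hwC x
  have hne : ∀ t, w (φ t) ≠ 0 :=
    hwK.ode_solution_ne hφ (t₀ := 0) (by rw [hφ0]; exact hwx.ne')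
  have hpos : ∀ t, 0 < w (φ t) :=
    ode_solution_pos_of_pos hw1.continuous hφ hne (s := 0) (by rwa [hφ0])
  have hmono : Monotone φ := monotone_of_deriv_nonneg (fun t => (hφ t).differentiableAt)
    fun t => by rw [(hφ t).deriv]; exact (hpos t).le
  have hφ1 : ContDiff ℝ 1 φ := (contDiff_two_of_ode hw1 hφ).of_le (by norm_num)
  have hlt : ∀ c, deriv U c = 0 → ∀ t, (c < x ↔ c < φ t) := fun c hc t => by
    rw [← hφ0]; exact ode_solution_lt_iff hφ hne ((hw0 c).2 hc) 0 t
  have hcx : ∀ c, deriv U c = 0 → c ≠ x := fun c hc h => hx (h ▸ hc)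
  have hcφ : ∀ c, deriv U c = 0 → ∀ t, c ≠ φ t := fun c hc t h =>
    hne t ((hw0 _).2 (h ▸ hc))
  -- Translates of a critical point bound the monotone `φ` on both sides, so it converges at both
  -- ends.
  obtain ⟨⟨c₁, hc₁x, hc₁⟩, c₂, hc₂x, hc₂⟩ := hper.exists_int_add_le (hm 0) x
  have hφneg : ∀ t, HasDerivAt (fun t => φ (-t)) (-w (φ (-t))) t := fun t => by
    have h := (hφ (-t)).comp t (hasDerivAt_neg t)
    rwa [mul_neg_one] at h
  have hψp : Continuous fun x => max (deriv U x) 0 := hU.continuous.max continuous_const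
  have hψm : Continuous fun x => min (deriv U x) 0 := hU.continuous.min continuous_const
  obtain ⟨Ψp, hΨp, hlipp⟩ := exists_lipschitz_primitive hψp (C := C)
    fun x => by
      have h : |max (deriv U x) 0| ≤ |deriv U x| := by
        simpa using abs_max_le_max_abs_abs (a := deriv U x) (b := 0)
      exact h.trans (hC x)
  obtain ⟨Ψm, hΨm, hlipm⟩ := exists_lipschitz_primitive hψm (C := C)
    fun x => by
      have h : |min (deriv U x) 0| ≤ |deriv U x| := by
        simpa using abs_min_le_max_abs_abs (a := deriv U x) (b := 0)
      exact h.trans (hC x)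
  rcases minBarrier_left_or_right (s := s) (B := B) (x := x) (P := φ '' Set.Iic 0)
    (Q := φ '' Set.Ici 0) hper hm
    hΨp hlipp (fun x => by simp only [hper x]) (fun s x => max_mul_le_lagrangian U s x)
    hΨm hlipm (fun x => by simp only [hper x]) (fun s x => min_mul_le_lagrangian U s x)
    (by
      rintro _ ⟨t, ht, rfl⟩
      exact ⟨hφ0 ▸ hmono ht, fun c hc h =>
        ((hlt c hc t).1 (lt_of_le_of_ne h (hcx c hc))).le⟩)
    (by
      rintro _ ⟨t, ht, rfl⟩
      exact ⟨hφ0 ▸ hmono ht, fun c hc h =>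
        not_lt.1 fun h' => h.not_gt ((hlt c hc t).2 h')⟩) with h | h
  · obtain ⟨c, hc⟩ : ∃ c, Tendsto φ atBot (𝓝 c) :=
      ⟨_, tendsto_atBot_ciInf hmono ⟨c₁, by
        rintro _ ⟨t, rfl⟩
        exact ((hlt c₁ hc₁ t).1 (lt_of_le_of_ne hc₁x (hcx c₁ hc₁))).le⟩⟩
    refine ⟨φ, hφ0, ?_, ?_, c,
      (hw0 c).1 (eq_zero_of_tendsto_ode_solution hw1.continuous hφ hc), hc⟩
    · refine isCalibratedCurve_minBarrier hper hm hfin hφ1 hΨp hψp (fun t => ?_) fun t ht => ?_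
      · have := hpos t
        rw [(hφ t).deriv]
        rcases hw with rfl | rfl
        · rw [max_eq_left this.le]; simp only [lagrangian]; ring
        · rw [max_eq_right (by linarith)]; simp [lagrangian]
      · rw [hφ0]; exact h _ ⟨t, ht, rfl⟩
    · rcases hw with rfl | rfl
      exacts [Or.inl hφ, Or.inr hφ]
  · obtain ⟨c, hc⟩ : ∃ c, Tendsto φ atTop (𝓝 c) :=
      ⟨_, tendsto_atTop_ciSup hmono ⟨c₂, by
        rintro _ ⟨t, rfl⟩
        exact not_lt.1 fun h' => (not_lt.2 hc₂x) ((hlt c₂ hc₂ t).2 h')⟩⟩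
    have hc' : Tendsto (fun t => φ (-t)) atBot (𝓝 c) := hc.comp tendsto_neg_atBot_atTop
    refine ⟨fun t => φ (-t), by simpa using hφ0, ?_, ?_, c, ?_, hc'⟩
    · refine isCalibratedCurve_minBarrier hper hm hfin (hφ1.comp contDiff_neg) hΨm hψm
        (fun t => ?_) fun t ht => ?_
      · have := hpos (-t)
        rw [(hφneg t).deriv]
        rcases hw with rfl | rfl
        · rw [min_eq_right this.le]; simp [lagrangian]
        · rw [min_eq_left (by linarith)]; simp only [lagrangian]; ring
      · simp only [neg_zero, hφ0]
        exact h _ ⟨-t, by simpa using ht, rfl⟩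
    · rcases hw with rfl | rfl
      exacts [Or.inr hφneg, Or.inl fun t => by simpa using hφneg t]
    · have := eq_zero_of_tendsto_ode_solution (v := fun x => -w x) hw1.continuous.neg hφneg hc'
      exact (hw0 c).1 (neg_eq_zero.1 this)

/-! ### The projected Aubry set -/

/-- The points of the circle below the critical points of `U`. -/
def criticalSet (U : ℝ → ℝ) : Set UnitAddCircle :=
  (fun x : ℝ => (x : UnitAddCircle)) '' {x | deriv U x = 0}

theorem coe_mem_criticalSet {U : ℝ → ℝ} (hper : Function.Periodic (deriv U) 1) {x : ℝ} :
    (x : UnitAddCircle) ∈ criticalSet U ↔ deriv U x = 0 := by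
  refine ⟨fun ⟨y, hy, hyx⟩ => ?_, fun h => ⟨x, h, rfl⟩⟩
  obtain ⟨n, rfl⟩ := exists_int_of_coe_eq hyx
  rw [← hy]
  simpa using (hper.int_mul n x).symm

/-- Otherwise `U` is antitone, so it is constant just to the right of a local minimum, which gives
an uncountable set of critical points. -/
theorem exists_deriv_pos_of_isLocalMin {U : ℝ → ℝ} (hU : Differentiable ℝ U)
    (hcount : {x | deriv U x = 0}.Countable) {c : ℝ} (hc : IsLocalMin U c) :
    ∃ x, 0 < deriv U x := by
  by_contra! h
  have hanti := antitone_of_deriv_nonpos hU h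
  obtain ⟨δ, hδ, hball⟩ := Metric.eventually_nhds_iff.1 hc
  have heq : Set.EqOn U (fun _ => U c) (Set.Ioo c (c + δ)) := fun y hy =>
    le_antisymm (hanti hy.1.le) (hball (by
      rw [Real.dist_eq, abs_of_pos (by linarith [hy.1])]; linarith [hy.2]))
  have hsub : Set.Ioo c (c + δ) ⊆ {x | deriv U x = 0} := fun y hy => by
    have : U =ᶠ[𝓝 y] fun _ => U c := by
      filter_upwards [isOpen_Ioo.mem_nhds hy] with z hz using heq hz
    simp [this.deriv_eq]
  have h0 := (hcount.mono hsub).measure_zero volume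
  simp [Real.volume_Ioo] at h0
  linarith

theorem exists_deriv_neg_of_isLocalMax {U : ℝ → ℝ} (hU : Differentiable ℝ U)
    (hcount : {x | deriv U x = 0}.Countable) {c : ℝ} (hc : IsLocalMax U c) :
    ∃ x, deriv U x < 0 := by
  have hd : ∀ x, deriv (fun x => -U x) x = -deriv U x := fun x => deriv.fun_neg
  obtain ⟨x, hx⟩ := exists_deriv_pos_of_isLocalMin hU.neg (by simpa [hd] using hcount) hc.neg
  exact ⟨x, by have := hd x; change 0 < deriv (fun x => -U x) x at hx; linarith⟩

/-- Without strict increase, `x` would be a local maximum of `F`. -/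
theorem Monotone.lt_add_of_hasDerivAt {F : ℝ → ℝ} (hF : Monotone F) {d x h : ℝ}
    (hd : HasDerivAt F d x) (hd0 : d ≠ 0) (hh : 0 < h) : F x < F (x + h) := by
  by_contra! hle
  have : IsLocalMax F x := by
    filter_upwards [Iio_mem_nhds (lt_add_of_pos_right x hh)] with y hy
    exact (hF (le_of_lt hy)).trans hle
  exact hd0 (this.hasDerivAt_eq_zero hd)

theorem Monotone.sub_lt_of_hasDerivAt {F : ℝ → ℝ} (hF : Monotone F) {d x h : ℝ}
    (hd : HasDerivAt F d x) (hd0 : d ≠ 0) (hh : 0 < h) : F (x - h) < F x := by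
  by_contra! hle
  have : IsLocalMin F x := by
    filter_upwards [Ioi_mem_nhds (sub_lt_self x hh)] with y hy
    exact hle.trans (hF (le_of_lt hy))
  exact hd0 (this.hasDerivAt_eq_zero hd)

/-- The increment over a period does not depend on its base point, so it can be computed at `x₀`. -/
theorem lt_add_one_of_periodic {F f : ℝ → ℝ} (hper : Function.Periodic f 1)
    (hF : ∀ x, HasDerivAt F (f x) x) (hf : ∀ x, 0 ≤ f x) {x₀ : ℝ} (hx₀ : 0 < f x₀) (x : ℝ) :
    F x < F (x + 1) := by
  have hmono : Monotone F := monotone_of_deriv_nonneg (fun x => (hF x).differentiableAt)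
    fun x => by rw [(hF x).deriv]; exact hf x
  have h1 := hmono.lt_add_of_hasDerivAt (hF x₀) hx₀.ne' one_pos
  have hd : ∀ y, HasDerivAt (fun y => F (y + 1) - F y) 0 y := fun y => by
    have h := ((hF (y + 1)).comp_add_const y 1).sub (hF y)
    rwa [hper y, sub_self] at h
  have := is_const_of_deriv_eq_zero (fun x => (hd x).differentiableAt) (fun x => (hd x).deriv)
    x x₀
  linarith

/-- A long loop through a point that is not critical has an action bounded from below. -/
theorem exists_pos_le_action_of_loop {U : ℝ → ℝ} (hper : Function.Periodic (deriv U) 1)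
    (hU : Differentiable ℝ U) (hU' : Continuous (deriv U))
    (hpos : ∃ x, 0 < deriv U x) (hneg : ∃ x, deriv U x < 0) {x : ℝ} (hx : deriv U x ≠ 0) :
    ∃ δ > 0, ∀ (T : ℝ) (γ : ℝ → ℝ) (n : ℤ), 1 ≤ T → AbsolutelyContinuousOnInterval γ 0 T →
      γ 0 = x → γ T = x + n → ENNReal.ofReal δ ≤ action U γ 0 T := by
  obtain ⟨C, hC⟩ := hper.exists_norm_le hU'
  have hψp : Continuous fun x => max (deriv U x) 0 := hU'.max continuous_const
  have hψm : Continuous fun x => min (deriv U x) 0 := hU'.min continuous_const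
  obtain ⟨P, hP, hlipP⟩ := exists_lipschitz_primitive hψp (C := C)
    fun x => by
      have h : |max (deriv U x) 0| ≤ |deriv U x| := by
        simpa using abs_max_le_max_abs_abs (a := deriv U x) (b := 0)
      exact h.trans (hC x)
  obtain ⟨Q, hQ, hlipQ⟩ := exists_lipschitz_primitive hψm (C := C)
    fun x => by
      have h : |min (deriv U x) 0| ≤ |deriv U x| := by
        simpa using abs_min_le_max_abs_abs (a := deriv U x) (b := 0)
      exact h.trans (hC x)
  have hPmono : Monotone P := monotone_of_deriv_nonneg (fun x => (hP x).differentiableAt)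
    fun x => by rw [(hP x).deriv]; exact le_max_right _ _
  have hQanti : Antitone Q := antitone_of_deriv_nonpos (fun x => (hQ x).differentiableAt)
    fun x => by rw [(hQ x).deriv]; exact min_le_right _ _
  have hPact : ∀ (γ : ℝ → ℝ) (a b : ℝ), a ≤ b → AbsolutelyContinuousOnInterval γ a b →
      ENNReal.ofReal (P (γ b) - P (γ a)) ≤ action U γ a b := fun γ a b hab hγ => by
    simpa using ofReal_sub_add_le_action (U := U) (e := 0) hab hγ hP hlipP
      fun t _ s => by simpa using max_mul_le_lagrangian U s (γ t)
  have hQact : ∀ (γ : ℝ → ℝ) (a b : ℝ), a ≤ b → AbsolutelyContinuousOnInterval γ a b →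
      ENNReal.ofReal (Q (γ b) - Q (γ a)) ≤ action U γ a b := fun γ a b hab hγ => by
    simpa using ofReal_sub_add_le_action (U := U) (e := 0) hab hγ hQ hlipQ
      fun t _ s => by simpa using min_mul_le_lagrangian U s (γ t)
  have hP1 : P x < P (x + 1) := by
    obtain ⟨x₀, h₀⟩ := hpos
    exact lt_add_one_of_periodic (fun x => by simp only [hper x]) hP
      (fun x => le_max_right _ _) (x₀ := x₀) (lt_max_of_lt_left h₀) x
  have hQ1 : Q x < Q (x - 1) := by
    obtain ⟨x₀, h₀⟩ := hneg
    have := lt_add_one_of_periodic (F := fun x => -Q x) (fun x => by simp only [hper x])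
      (fun x => (hQ x).neg)
      (fun x => neg_nonneg.2 (min_le_right _ _)) (x₀ := x₀)
      (neg_pos.2 (min_lt_of_left_lt h₀)) (x - 1)
    simp only [sub_add_cancel] at this
    linarith
  obtain ⟨ε, hε, hball⟩ : ∃ ε > 0, ∀ y, |y - x| < ε → |deriv U x| / 2 < |deriv U y| := by
    have h : ∀ᶠ y in 𝓝 x, |deriv U x| / 2 < |deriv U y| :=
      hU'.abs.tendsto x (Ioi_mem_nhds (half_lt_self (abs_pos.2 hx)))
    simpa [Real.dist_eq] using Metric.eventually_nhds_iff.1 h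
  -- `P - Q` has derivative `|U'|`. Its increment between two points bounds the cost of a round
  -- trip: `P` pays for the way right, `Q` for the way left.
  have hA : ∀ y, HasDerivAt (fun y => P y - Q y)
      (max (deriv U y) 0 - min (deriv U y) 0) y := fun y => (hP y).sub (hQ y)
  have hAmono : Monotone fun y => P y - Q y := fun y z h => sub_le_sub (hPmono h) (hQanti h)
  have hAx : max (deriv U x) 0 - min (deriv U x) 0 ≠ 0 := by
    rw [max_sub_min_eq_abs]; simpa using hx
  have hA1 := hAmono.lt_add_of_hasDerivAt (hA x) hAx hε
  have hA2 := hAmono.sub_lt_of_hasDerivAt (hA x) hAx hε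
  have hκ : 0 < (|deriv U x| / 2) ^ 2 / 4 := by positivity
  -- The five terms are the costs of winding right, winding left, an excursion to distance `ε` on
  -- the right, one on the left, and staying within `ε` for unit time.
  refine ⟨min (min (P (x + 1) - P x) (Q (x - 1) - Q x)) (min (min
    (P (x + ε) - Q (x + ε) - (P x - Q x)) (P x - Q x - (P (x - ε) - Q (x - ε))))
    ((|deriv U x| / 2) ^ 2 / 4)), ?_, ?_⟩
  · refine lt_min (lt_min ?_ ?_) (lt_min (lt_min ?_ ?_) hκ) <;> linarith
  intro T γ n hT hγ h0 hγT
  have hT0 : 0 ≤ T := by linarith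
  rcases lt_trichotomy n 0 with hn | rfl | hn
  · have hn' : (n : ℝ) ≤ -1 := by exact_mod_cast Int.le_sub_one_of_lt hn
    refine le_trans (ENNReal.ofReal_le_ofReal ?_) (hQact γ 0 T hT0 hγ)
    refine (min_le_left _ _).trans ((min_le_right _ _).trans ?_)
    rw [h0, hγT]
    gcongr
    exact hQanti (by linarith)
  · rw [Int.cast_zero, add_zero] at hγT
    by_cases hleave : ∃ t ∈ Set.Icc 0 T, ε ≤ |γ t - x|
    · obtain ⟨t, ht, hεt⟩ := hleave
      have ht' : t ∈ Set.uIcc 0 T := by rwa [Set.uIcc_of_le hT0]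
      have hγ1 := hγ.mono (Set.uIcc_subset_uIcc_left ht')
      have hγ2 := hγ.mono (Set.uIcc_subset_uIcc_right ht')
      rw [← action_add U γ ht.1 ht.2]
      rcases le_abs.1 hεt with h | h
      · refine le_trans ?_ (add_le_add (hPact γ 0 t ht.1 hγ1) (hQact γ t T ht.2 hγ2))
        rw [h0, hγT, ← ENNReal.ofReal_add (sub_nonneg.2 (hPmono (by linarith)))
          (sub_nonneg.2 (hQanti (by linarith)))]
        refine ENNReal.ofReal_le_ofReal ((min_le_right _ _).trans ((min_le_left _ _).trans
          ((min_le_left _ _).trans ?_)))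
        have := hAmono (by linarith : x + ε ≤ γ t)
        linarith
      · refine le_trans ?_ (add_le_add (hQact γ 0 t ht.1 hγ1) (hPact γ t T ht.2 hγ2))
        rw [h0, hγT, ← ENNReal.ofReal_add (sub_nonneg.2 (hQanti (by linarith)))
          (sub_nonneg.2 (hPmono (by linarith)))]
        refine ENNReal.ofReal_le_ofReal ((min_le_right _ _).trans ((min_le_left _ _).trans
          ((min_le_right _ _).trans ?_)))
        have := hAmono (by linarith : γ t ≤ x - ε)
        linarith
    · push Not at hleave
      have hlip : LipschitzWith C fun y => U y / 2 := by
        refine lipschitzWith_of_nnnorm_deriv_le (hU.div_const 2) fun y => ?_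
        have h := hC y
        have h' : ‖deriv U y / 2‖ ≤ C := by
          rw [norm_div, Real.norm_two]
          linarith [norm_nonneg (deriv U y)]
        rw [deriv_div_const]
        exact h'
      -- Here `L ≥ U' s / 2 + U'² / 4`. The first term integrates to zero on a closed loop; the
      -- second is bounded below near `x`, and `T ≥ 1`.
      have := ofReal_sub_add_le_action (U := U) (e := (|deriv U x| / 2) ^ 2 / 4) hT0 hγ
        (fun y => (hU y).hasDerivAt.div_const 2) hlip fun t ht s => by
          have h1 := hball _ (hleave t ht)
          have h2 : (|deriv U x| / 2) ^ 2 ≤ deriv U (γ t) ^ 2 := by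
            rw [← sq_abs (deriv U (γ t))]
            gcongr
          unfold lagrangian
          nlinarith [sq_nonneg s]
      refine le_trans (ENNReal.ofReal_le_ofReal ?_) this
      refine (min_le_right _ _).trans ((min_le_right _ _).trans ?_)
      rw [h0, hγT]
      nlinarith
  · have hn' : (1 : ℝ) ≤ n := by exact_mod_cast hn
    refine le_trans (ENNReal.ofReal_le_ofReal ?_) (hPact γ 0 T hT0 hγ)
    refine (min_le_left _ _).trans ((min_le_left _ _).trans ?_)
    rw [h0, hγT]
    gcongr
    exact hPmono (by linarith)

theorem projectedAubrySet_eq_criticalSet {U : ℝ → ℝ} (hper : Function.Periodic (deriv U) 1)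
    (hU : Differentiable ℝ U) (hU' : Continuous (deriv U))
    (hpos : ∃ x, 0 < deriv U x) (hneg : ∃ x, deriv U x < 0) :
    projectedAubrySet U = criticalSet U := by
  ext p
  obtain ⟨x, rfl⟩ := QuotientAddGroup.mk_surjective p
  change peierlsBarrier U (x : UnitAddCircle) x = 0 ↔ (x : UnitAddCircle) ∈ criticalSet U
  rw [coe_mem_criticalSet hper]
  refine ⟨fun h => ?_, fun h => ?_⟩
  · by_contra hx
    obtain ⟨δ, hδ, hle⟩ := exists_pos_le_action_of_loop hper hU hU' hpos hneg hx
    have : ENNReal.ofReal δ ≤ peierlsBarrier U (x : UnitAddCircle) x := by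
      refine le_liminf_of_le (by isBoundedDefault) ?_
      filter_upwards [eventually_ge_atTop 1] with T hT
      refine le_iInf₂ fun γ hγ => le_iInf₂ fun h0 h1 => ?_
      obtain ⟨l, hl⟩ := exists_int_of_coe_eq h0
      obtain ⟨n, hn⟩ := exists_int_of_coe_eq h1
      rw [action_congr (η := fun t => γ t - l) hper l fun t _ => by ring]
      refine hle T _ (n - l) hT (hγ.sub (absolutelyContinuousOnInterval_const l 0 T)) ?_ ?_
      · rw [hl]; ring
      · rw [hn]; push_cast; ring
    rw [h] at this
    exact (ENNReal.ofReal_pos.2 hδ).not_ge this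
  · rw [peierlsBarrier_eq_iInf hper h]
    exact le_antisymm (iInf₂_le_of_le 0 le_rfl
      (leastAction_self_of_deriv_eq_zero h 0).le) bot_le

/-! ### The Euler-Lagrange flow -/

theorem deriv_lagrangian_fst (U : ℝ → ℝ) (s x : ℝ) :
    deriv (fun s => lagrangian U s x) s = (s + deriv U x) / 2 := by
  have h := (((hasDerivAt_id s).add_const (deriv U x)).pow 2).div_const 4
  have h' : HasDerivAt (fun s => lagrangian U s x) _ s := h
  rw [h'.deriv]; simp; ring

theorem deriv_lagrangian_snd {U : ℝ → ℝ} (hU : Differentiable ℝ (deriv U)) (s x : ℝ) :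
    deriv (fun x => lagrangian U s x) x = (s + deriv U x) * deriv (deriv U) x / 2 := by
  have h := (((hU x).hasDerivAt.const_add s).pow 2).div_const 4
  have h' : HasDerivAt (fun x => lagrangian U s x) _ x := h
  rw [h'.deriv]; simp; ring

/-- Both partial derivatives of `L` carry the factor `s + U'`, which vanishes along the curve. -/
theorem isEulerLagrangeCurve_of_gradient {U γ : ℝ → ℝ} (hU : ContDiff ℝ 1 (deriv U))
    (hγ : ∀ t, HasDerivAt γ (-deriv U (γ t)) t) : IsEulerLagrangeCurve U γ := by
  refine ⟨contDiff_two_of_ode (v := fun x => -deriv U x) hU.neg hγ, fun t => ?_⟩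
  simp only [deriv_lagrangian_fst, deriv_lagrangian_snd (hU.differentiable one_ne_zero),
    (hγ _).deriv, neg_add_cancel]
  simp

/-- An Euler-Lagrange curve that starts on the graph of `-U'` is a gradient curve. -/
theorem IsEulerLagrangeCurve.hasDerivAt_neg_deriv {U γ : ℝ → ℝ} (hU : ContDiff ℝ 1 (deriv U))
    {K : NNReal} (hK : ∀ x, ‖deriv (deriv U) x‖ ≤ K) (hγ : IsEulerLagrangeCurve U γ)
    (h0 : deriv γ 0 = -deriv U (γ 0)) (t : ℝ) : HasDerivAt γ (-deriv U (γ t)) t := by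
  obtain ⟨h2, hEL⟩ := hγ
  have hdiff : Differentiable ℝ γ := h2.differentiable two_ne_zero
  have hdiff' : Differentiable ℝ (deriv γ) :=
    (contDiff_succ_iff_deriv (n := 1).1 h2).2.2.differentiable one_ne_zero
  have hdU := hU.differentiable one_ne_zero
  -- Twice the momentum: the Euler-Lagrange equation makes it solve the linear equation `w' = U''(γ)
  -- w`, so it stays zero.
  set w : ℝ → ℝ := fun t => deriv γ t + deriv U (γ t) with hw
  have hwd : Differentiable ℝ w := hdiff'.add (hdU.comp hdiff)
  have hwt : ∀ t, HasDerivAt w (deriv (deriv U) (γ t) * w t) t := by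
    intro t
    have h := hEL t
    simp only [deriv_lagrangian_fst, deriv_lagrangian_snd hdU] at h
    rw [deriv_div_const] at h
    have h' : deriv w t = deriv (deriv U) (γ t) * w t := by
      change deriv w t / 2 = w t * deriv (deriv U) (γ t) / 2 at h
      linarith
    rw [← h']
    exact (hwd t).hasDerivAt
  have hw0 : w = fun _ => 0 := by
    refine ODE_solution_unique_univ (v := fun t y => deriv (deriv U) (γ t) * y) (K := K)
      (s := fun _ => Set.univ) (t₀ := 0) (fun t => ?_) (fun t => ⟨hwt t, trivial⟩)
      (fun t => ⟨by simpa using hasDerivAt_const t (0 : ℝ), trivial⟩) (by simp [hw, h0])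
    refine (LipschitzWith.of_dist_le_mul fun y z => ?_).lipschitzOnWith
    rw [Real.dist_eq, Real.dist_eq, ← mul_sub, abs_mul]
    gcongr
    exact hK _
  have : deriv γ t + deriv U (γ t) = 0 := congrFun hw0 t
  rw [← eq_neg_of_add_eq_zero_left this]
  exact (hdiff t).hasDerivAt

/-! ### Mather measures -/

theorem deriv_equivIco {U : ℝ → ℝ} (hper : Function.Periodic (deriv U) 1) (x : ℝ) :
    deriv U (AddCircle.equivIco (1 : ℝ) 0 (x : UnitAddCircle) : ℝ) = deriv U x := by
  obtain ⟨n, hn⟩ := exists_int_of_coe_eq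
    (AddCircle.coe_equivIco : ((AddCircle.equivIco (1 : ℝ) 0 (x : UnitAddCircle) : ℝ) :
      UnitAddCircle) = x)
  rw [hn]
  simpa using hper.int_mul n x

theorem measurable_averageAction_integrand {U : ℝ → ℝ} (hU : Continuous (deriv U)) :
    Measurable fun p : ℝ × UnitAddCircle =>
      lagrangian U p.1 (AddCircle.equivIco (1 : ℝ) 0 p.2 : ℝ) := by
  have h : Measurable fun p : ℝ × UnitAddCircle => (AddCircle.equivIco (1 : ℝ) 0 p.2 : ℝ) :=
    measurable_subtype_coe.comp ((AddCircle.measurableEquivIco (1 : ℝ) 0).measurable.comp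
      measurable_snd)
  unfold lagrangian
  exact ((measurable_fst.add (hU.measurable.comp h)).pow_const 2).div_const 4

/-- `flowPreimage` only asks for some Euler-Lagrange curve, so uniqueness is needed: one starting at
`(0, c)` is a gradient curve, hence constant on the circle. -/
theorem isInvariantProb_dirac {U : ℝ → ℝ} (hper : Function.Periodic (deriv U) 1)
    (hU : ContDiff ℝ 1 (deriv U)) {c : ℝ} (hc : deriv U c = 0) :
    IsInvariantProb U (Measure.dirac (0, (c : UnitAddCircle))) := by
  refine ⟨inferInstance, fun t B _ => ?_⟩
  suffices h : (0, (c : UnitAddCircle)) ∈ flowPreimage U t B ↔ (0, (c : UnitAddCircle)) ∈ B by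
    rw [Measure.dirac_apply, Measure.dirac_apply]
    by_cases hB : (0, (c : UnitAddCircle)) ∈ B <;> simp [h, hB]
  obtain ⟨K, hK⟩ := hper.exists_lipschitzWith hU
  constructor
  · rintro ⟨γ, hγ, h0, ht⟩
    obtain ⟨h1, h2⟩ := Prod.ext_iff.1 h0
    simp only [tangentLift] at h1 h2
    have hcrit : deriv U (γ 0) = 0 := by
      rw [← coe_mem_criticalSet hper, h2, coe_mem_criticalSet hper, hc]
    have hgrad := hγ.hasDerivAt_neg_deriv hU (fun x => norm_deriv_le_of_lipschitz hK)
      (by rw [h1, hcrit, neg_zero])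
    have hconst : γ = fun _ => γ 0 := hK.neg.ode_solution_unique hgrad
      (fun t => by simpa [hcrit] using hasDerivAt_const t (γ 0)) (t₀ := 0) rfl
    rw [tangentLift, hconst, h2] at ht
    simpa using ht
  · intro h
    refine ⟨fun _ => c, isEulerLagrangeCurve_of_gradient hU fun t => ?_, ?_, ?_⟩
    · rw [hc, neg_zero]; exact hasDerivAt_const t c
    · simp [tangentLift]
    · simpa [tangentLift] using h

theorem averageAction_dirac {U : ℝ → ℝ} (hper : Function.Periodic (deriv U) 1) {c : ℝ}
    (hc : deriv U c = 0) : averageAction U (Measure.dirac (0, (c : UnitAddCircle))) = 0 := by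
  rw [averageAction, lintegral_dirac, lagrangian, deriv_equivIco hper, hc]
  simp

theorem isMatherMeasure_dirac {U : ℝ → ℝ} (hper : Function.Periodic (deriv U) 1)
    (hU : ContDiff ℝ 1 (deriv U)) {c : ℝ} (hc : deriv U c = 0) :
    IsMatherMeasure U (Measure.dirac (0, (c : UnitAddCircle))) :=
  ⟨isInvariantProb_dirac hper hU hc, fun ν _ => by rw [averageAction_dirac hper hc]; exact bot_le⟩

/-- Mather measures live on the graph of `-U'`. -/
theorem IsMatherMeasure.ae_fst_eq {U : ℝ → ℝ} (hper : Function.Periodic (deriv U) 1)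
    (hU : ContDiff ℝ 1 (deriv U)) {c : ℝ} (hc : deriv U c = 0)
    {μ : Measure (ℝ × UnitAddCircle)} (hμ : IsMatherMeasure U μ) :
    ∀ᵐ p ∂μ, ∀ x : ℝ, (x : UnitAddCircle) = p.2 → p.1 = -deriv U x := by
  have h0 : averageAction U μ = 0 := le_antisymm
    ((hμ.2 _ (isInvariantProb_dirac hper hU hc)).trans (averageAction_dirac hper hc).le) bot_le
  rw [averageAction, lintegral_eq_zero_iff
    (measurable_averageAction_integrand hU.continuous).ennreal_ofReal] at h0
  filter_upwards [h0] with p hp x hx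
  simp only [Pi.zero_apply, ENNReal.ofReal_eq_zero] at hp
  have hp' := le_antisymm hp (lagrangian_nonneg _ _ _)
  rw [← hx, lagrangian, deriv_equivIco hper] at hp'
  have : p.1 + deriv U x = 0 := by
    have : (p.1 + deriv U x) ^ 2 = 0 := by linarith
    exact pow_eq_zero_iff two_ne_zero |>.1 this
  linarith

/-- The lift is injective by Rolle and trapped strictly between consecutive translates of `c`, so
two of its values never differ by a nonzero integer. -/
theorem ode_solution_coe_injective {v γ : ℝ → ℝ} (hper : Function.Periodic v 1)
    (hγ : ∀ t, HasDerivAt γ (v (γ t)) t) (hne : ∀ t, v (γ t) ≠ 0) {c : ℝ} (hc : v c = 0) :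
    Function.Injective fun t => (γ t : UnitAddCircle) := by
  have hinj : ∀ r s, r < s → γ r ≠ γ s := fun r s hrs h => by
    obtain ⟨z, _, hz⟩ := exists_hasDerivAt_eq_zero hrs
      (fun t _ => (hγ t).continuousAt.continuousWithinAt) h (fun t _ => hγ t)
    exact hne z hz
  have hcn : ∀ n : ℤ, v (c + n) = 0 := fun n => by
    rw [← hc]; simpa using hper.int_mul n c
  have hlow : ∀ t, c + ⌊γ 0 - c⌋ < γ t := fun t => by
    refine (ode_solution_lt_iff hγ hne (hcn _) 0 t).1 (lt_of_le_of_ne ?_ fun h => ?_)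
    · linarith [Int.floor_le (γ 0 - c)]
    · exact hne 0 (h ▸ hcn _)
  have hup : ∀ t, γ t ≤ c + (⌊γ 0 - c⌋ + 1 : ℤ) := fun t => by
    refine not_lt.1 fun h => ?_
    have := (ode_solution_lt_iff hγ hne (hcn _) t 0).1 h
    push_cast at this
    linarith [Int.lt_floor_add_one (γ 0 - c)]
  have hup' : ∀ t, γ t < c + (⌊γ 0 - c⌋ + 1 : ℤ) := fun t =>
    lt_of_le_of_ne (hup t) fun h => hne t (h ▸ hcn _)
  intro r s hrs
  obtain ⟨n, hn⟩ := exists_int_of_coe_eq hrs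
  have h1 := hlow r; have h2 := hup' r; have h3 := hlow s; have h4 := hup' s
  push_cast at h2 h4
  have hn0 : n = 0 := by
    have h5 : (n : ℝ) < 1 := by linarith
    have h6 : (-1 : ℝ) < n := by linarith
    have h5' : n < 1 := by exact_mod_cast h5
    have h6' : -1 < n := by exact_mod_cast h6
    omega
  rw [hn0, Int.cast_zero, add_zero] at hn
  by_contra hne'
  rcases lt_or_gt_of_ne hne' with h | h
  · exact hinj r s h hn
  · exact hinj s r h hn.symm

/-- The support of a Mather measure lies over the critical points. -/
theorem IsMatherMeasure.snd_mem_criticalSet {U : ℝ → ℝ} (hper : Function.Periodic (deriv U) 1)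
    (hU : ContDiff ℝ 1 (deriv U)) {c : ℝ} (hc : deriv U c = 0)
    {μ : Measure (ℝ × UnitAddCircle)} (hμ : IsMatherMeasure U μ) {p : ℝ × UnitAddCircle}
    (hp : p ∈ μ.support) : p.2 ∈ criticalSet U := by
  obtain ⟨x, hx⟩ := QuotientAddGroup.mk_surjective p.2
  change (x : UnitAddCircle) = p.2 at hx
  rw [← hx, coe_mem_criticalSet hper]
  by_contra hcrit
  refine Measure.notMem_support_iff_exists.2 ?_ hp
  obtain ⟨C, hC⟩ := hper.exists_norm_le hU.continuous
  obtain ⟨K, hK⟩ := hper.exists_lipschitzWith hU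
  obtain ⟨γ, hγ0, hγ⟩ := hK.neg.exists_ode_solution (C := C)
    (fun x => (norm_neg _).trans_le (hC x)) x
  have hne : ∀ t, (-deriv U) (γ t) ≠ 0 := hK.neg.ode_solution_ne hγ (t₀ := 0) (by simpa [hγ0])
  have hinj := ode_solution_coe_injective (v := -deriv U) (fun x => by simp [hper x]) hγ hne
    (c := c) (by simpa)
  have hγ2 : ContDiff ℝ 2 γ := contDiff_two_of_ode hU.neg hγ
  set g : ℝ → UnitAddCircle := fun t => (γ t : UnitAddCircle) with hg
  have hgc : Continuous g := (AddCircle.continuous_mk' 1).comp hγ2.continuous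
  -- `N` lies over the orbit arc of times in `(-1, 1)`, `B` over that of times at least 1. Flowing
  -- for time 2 sends almost all of `N ∪ B` into `B`, so invariance forces `μ N = 0`.
  set B : Set (ℝ × UnitAddCircle) := Prod.snd ⁻¹' (g '' Set.Ici 1) with hB
  set N : Set (ℝ × UnitAddCircle) := Prod.snd ⁻¹' (g '' Set.Ioo (-1) 1) with hN
  have hBm : MeasurableSet B := by
    refine measurable_snd ?_
    have : g '' Set.Ici 1 = ⋃ n : ℕ, g '' Set.Icc 1 n := by
      rw [← Set.image_iUnion]
      congr 1
      ext t
      simp only [Set.mem_Ici, Set.mem_iUnion, Set.mem_Icc, exists_and_left]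
      exact ⟨fun h => ⟨h, exists_nat_ge t⟩, fun h => h.1⟩
    rw [this]
    exact MeasurableSet.iUnion fun n => (isCompact_Icc.image hgc).isClosed.measurableSet
  have hNp : N ∈ 𝓝 p := by
    refine continuous_snd.continuousAt ?_
    -- The velocity at time 0 is nonzero, so `γ` is open there, and so is the projection to the
    -- circle.
    have h1 : γ '' Set.Ioo (-1) 1 ∈ 𝓝 (γ 0) := by
      have hs : HasStrictDerivAt γ ((-deriv U) (γ 0)) 0 :=
        hγ2.contDiffAt.hasStrictDerivAt' (hγ 0) two_ne_zero
      rw [← hs.map_nhds_eq (hne 0)]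
      exact image_mem_map (Ioo_mem_nhds (by norm_num) (by norm_num))
    have h2 := (QuotientAddGroup.isOpenMap_coe
      (N := AddSubgroup.zmultiples (1 : ℝ))).image_mem_nhds h1
    rw [Set.image_image, hγ0] at h2
    rw [← hx]
    exact h2
  have hdisj : Disjoint N B := by
    rw [Set.disjoint_left]
    rintro q ⟨r, hr, hrq⟩ ⟨s, hs, hsq⟩
    have := hinj (hrq.trans hsq.symm)
    rw [this] at hr
    exact hr.2.not_ge hs
  have hsub : ∀ᵐ q ∂μ, q ∈ N ∪ B → q ∈ flowPreimage U 2 B := by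
    filter_upwards [hμ.ae_fst_eq hper hU hc] with q hq hqN
    obtain ⟨r, hr, hrq⟩ : ∃ r : ℝ, -1 ≤ r ∧ g r = q.2 := by
      rcases hqN with ⟨r, hr, h⟩ | ⟨r, hr, h⟩
      · exact ⟨r, hr.1.le, h⟩
      · exact ⟨r, le_trans (by norm_num) hr, h⟩
    have hηd : ∀ t, HasDerivAt (fun t => γ (t + r)) (-deriv U (γ (t + r))) t := fun t =>
      (hγ (t + r)).comp_add_const t r
    refine ⟨fun t => γ (t + r), isEulerLagrangeCurve_of_gradient hU hηd, ?_, ?_⟩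
    · refine Prod.ext ?_ ?_
      · simp only [tangentLift, (hηd 0).deriv, zero_add]
        exact (hq _ hrq).symm
      · simpa [tangentLift] using hrq
    · exact ⟨2 + r, by simp only [Set.mem_Ici]; linarith, rfl⟩
  have := hμ.1.1
  have hle : μ (N ∪ B) ≤ μ B := (measure_mono_ae hsub).trans (hμ.1.2 2 B hBm).le
  rw [measure_union hdisj hBm] at hle
  refine ⟨N, hNp, ?_⟩
  by_contra hN0
  exact (ENNReal.lt_add_right (measure_ne_top μ B) hN0).not_ge (by rwa [add_comm] at hle)

theorem isClosed_criticalSet {U : ℝ → ℝ} (hper : Function.Periodic (deriv U) 1)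
    (hU : Continuous (deriv U)) : IsClosed (criticalSet U) := by
  rw [← (QuotientAddGroup.isQuotientMap_mk
    (N := AddSubgroup.zmultiples (1 : ℝ))).isClosed_preimage]
  have : (QuotientAddGroup.mk : ℝ → ℝ ⧸ AddSubgroup.zmultiples (1 : ℝ)) ⁻¹' criticalSet U
      = {x | deriv U x = 0} := by
    ext x
    exact coe_mem_criticalSet hper
  rw [this]
  exact isClosed_eq hU continuous_const

theorem projectedMatherSet_eq_criticalSet {U : ℝ → ℝ} (hper : Function.Periodic (deriv U) 1)
    (hU : ContDiff ℝ 1 (deriv U)) {c : ℝ} (hc : deriv U c = 0) :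
    projectedMatherSet U = criticalSet U := by
  refine Set.Subset.antisymm ?_ ?_
  · refine Set.image_subset_iff.2 (closure_minimal ?_
      ((isClosed_criticalSet hper hU.continuous).preimage continuous_snd))
    rintro p ⟨μ, hμ, hp⟩
    exact hμ.snd_mem_criticalSet hper hU hc hp
  · rintro _ ⟨x, hx, rfl⟩
    refine ⟨(0, (x : UnitAddCircle)), subset_closure ⟨_, isMatherMeasure_dirac hper hU hx, ?_⟩,
      rfl⟩
    refine (Measure.mem_support_iff_forall _).2 fun V hV => ?_
    rw [Measure.dirac_apply_of_mem (mem_of_mem_nhds hV)]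
    exact one_pos

theorem coe_periodic_of_add_one {m : ℤ → ℝ} {k : ℤ} (hm : ∀ i : ℤ, m (i + k) = m i + 1) :
    Function.Periodic (fun i => (m i : UnitAddCircle)) k := fun i => by
  have := coe_intCast_unitAddCircle 1
  rw [Int.cast_one] at this
  simp only [hm, AddCircle.coe_add, this, add_zero]

end

/-! ### The main theorem for the Freidlin-Wentzell landscape -/

theorem mainTheorem7 (U : ℝ → ℝ) (b : ℝ) (k : ℕ) (m M : ℤ → ℝ)
    (hU : ContDiff ℝ ∞ U)
    (hskew : ∀ x : ℝ, U (x + 1) = U x - b)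
    (hk : 1 ≤ k)
    (hm : ∀ i : ℤ, m (i + k) = m i + 1)
    (hM : ∀ i : ℤ, M (i + k) = M i + 1)
    (hinter : ∀ i : ℤ, M (i - 1) < m i ∧ m i < M i)
    (hmin : ∀ i : ℤ, IsLocalMin U (m i))
    (hmax : ∀ i : ℤ, IsLocalMax U (M i))
    (hcrit : ∀ x : ℝ, deriv U x = 0 ↔ (∃ i : ℤ, x = m i) ∨ ∃ i : ℤ, x = M i) :
    (∀ x : UnitAddCircle, ∃ γ : ℝ → ℝ,
      (γ 0 : UnitAddCircle) = x ∧
      IsCalibratedCurve U (landscape U k m) γ ∧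
      ((∀ t ≤ 0, HasDerivWithinAt γ (deriv U (γ t)) (Set.Iic 0) t) ∨
        (∀ t ≤ 0, HasDerivWithinAt γ (-deriv U (γ t)) (Set.Iic 0) t)) ∧
      ∃ c : ℝ, deriv U c = 0 ∧ Tendsto γ atBot (𝓝 c)) ∧
    projectedMatherSet U = projectedAubrySet U ∧
    projectedAubrySet U =
      {p : UnitAddCircle | ∃ i ∈ Finset.Icc (1 : ℤ) k,
        p = (m i : UnitAddCircle) ∨ p = (M i : UnitAddCircle)} := by
  have hper : Function.Periodic (deriv U) 1 := fun x => by
    rw [← deriv_comp_add_const, show (fun y => U (y + 1)) = fun y => U y - b from funext hskew,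
      deriv_sub_const]
  have hdiff : Differentiable ℝ U := hU.differentiable (by simp)
  have hU1 : ContDiff ℝ 1 (deriv U) :=
    (contDiff_succ_iff_deriv (n := 1).1 (hU.of_le (by norm_cast))).2.2
  have hm0 : ∀ i, deriv U (m i) = 0 := fun i => (hcrit _).2 (Or.inl ⟨i, rfl⟩)
  have hcount : {x | deriv U x = 0}.Countable := by
    refine ((Set.countable_range m).union (Set.countable_range M)).mono fun x hx => ?_
    rcases (hcrit x).1 hx with ⟨i, rfl⟩ | ⟨i, rfl⟩
    exacts [Or.inl ⟨i, rfl⟩, Or.inr ⟨i, rfl⟩]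
  have hAubry := projectedAubrySet_eq_criticalSet hper hdiff hU1.continuous
    (exists_deriv_pos_of_isLocalMin hdiff hcount (hmin 0))
    (exists_deriv_neg_of_isLocalMax hdiff hcount (hmax 0))
  refine ⟨fun x => ?_, ?_, ?_⟩
  · obtain ⟨y, rfl⟩ := QuotientAddGroup.mk_surjective x
    have h1 : (1 : ℤ) ∈ Finset.Icc (1 : ℤ) k := by simp; omega
    -- `landscape` unfolds to the real part of `minBarrier` with weights `boundaryValue`.
    obtain ⟨γ, h0, hcal, hγ, hlim⟩ := exists_calibratedCurve_minBarrier hper hU1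
      (s := Finset.Icc (1 : ℤ) k) (B := boundaryValue U k m) hm0
      (minBarrier_lt_top hper hU1.continuous hm0 h1
        (boundaryValue_lt_top hU1.continuous hk m 1)) y
    exact ⟨γ, congrArg _ h0, hcal, hγ.imp (fun h t _ => (h t).hasDerivWithinAt)
      (fun h t _ => (h t).hasDerivWithinAt), hlim⟩
  · rw [hAubry, projectedMatherSet_eq_criticalSet hper hU1 (hm0 0)]
  · have hk0 : (0 : ℤ) < k := by exact_mod_cast hk
    rw [hAubry]
    ext p
    constructor
    · rintro ⟨x, hx, rfl⟩
      rcases (hcrit x).1 hx with ⟨i, rfl⟩ | ⟨i, rfl⟩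
      · obtain ⟨j, hj, h⟩ := (coe_periodic_of_add_one hm).exists_mem_Ioc hk0 i 0
        exact ⟨j, by simp at hj ⊢; omega, Or.inl h⟩
      · obtain ⟨j, hj, h⟩ := (coe_periodic_of_add_one hM).exists_mem_Ioc hk0 i 0
        exact ⟨j, by simp at hj ⊢; omega, Or.inr h⟩
    · rintro ⟨i, _, rfl | rfl⟩
      · exact ⟨m i, hm0 i, rfl⟩
      · exact ⟨M i, (hcrit _).2 (Or.inr ⟨i, rfl⟩), rfl⟩
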